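/- Let $\sigma^x,\sigma^y,\sigma^z$ be the Pauli matrices. For bounded real sequences $\mu=\{\mu_j\}_{j\in\mathbb Z}$, $\nu=\{\nu_j\}_{j\in\mathbb Z}$ and a finite interval $\Lambda=[m,n]\cap\mathbb Z$, let $$H_\Lambda=-\sum_{j=m}^{n-1}\mu_j\left(\sigma^x_j\sigma^x_{j+1}+\sigma^y_j\sigma^y_{j+1}\right)-\sum_{j=m}^{n}\nu_j\sigma^z_j$$ be the Hamiltonian of the isotropic $XY$ chain on $\bigotimes_{j\in\Lambda}\mathbb C^2$, where $A_j$ denotes the matrix $A\in\mathbb C^{2\times2}$ acting on the site $j$. Let $\tau^\Lambda_t(A)=e^{itH_\Lambda}Ae^{-itH_\Lambda}$, and for $S\subseteq\Lambda$ let $\mathcal A_S=\bigotimes_{j\in S}\mathbb C^{2\times 2}$ be the algebra of observables on $S$. The chain is said to satisfy a Lieb–Robinson bound with constants $C,c,v>0$ if $$\left\|[\tau^\Lambda_t(A),B]\right\|\le C\,\|A\|\,\|B\|\,e^{-c(d-v|t|)}$$ for all finite intervals $\Lambda$, all disjoint nonempty $S_1,S_2\subseteq\Lambda$, all $A\in\mathcal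 A_{S_1}$, $B\in\mathcal A_{S_2}$ and all $t\in\mathbb R$, where $d=\min\{|n_1-n_2|:n_1\in S_1,\,n_2\in S_2\}$. Here $c$ and $v$ are uniform, and $C=C(S_1,S_2)$ may depend on $S_1$ and $S_2$, but only on each of them up to translation: $C(S_1+a,S_2+b)=C(S_1,S_2)$ for all $a,b\in\mathbb Z$. **Theorem.** Let $\mu,\nu\in\ell^\infty(\mathbb Z,\mathbb R)$ with $\inf_j\mu_j>0$. There is a constant $\eta_0>0$, depending only on $\|\mu\|_\infty$, $\|\mu^{-1}\|_\infty$ and $\|\nu\|_\infty$, with the following property. If there exist positive integers $q_n$ and $q_n$-periodic sequences $\mu^{(n)},\nu^{(n)}\in\ell^\infty(\mathbb Z,\mathbb R)$ with $$\lim_{n\to\infty}e^{\eta_0q_{n+1}}\|\mu-\mu^{(n)}\|_\infty=\lim_{n\to\infty}e^{\eta_0q_{n+1}}\|\nu-\nu^{(n)}\|_\infty=0,$$ then there exists $v_0>0$ such that, whenever the chain satisfies a Lieb–Robinson bound with some constants $C,c,v>0$, one has $v\ge v_0$. -/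

import Mathlib

open Filter Topology
open scoped Matrix.Norms.L2Operator

noncomputable section

namespace XYChain

/-- The classical configurations on a finite set `Λ` of sites. They index the product basis of
`⨂_{j ∈ Λ} ℂ²`, so that this Hilbert space is `EuclideanSpace ℂ (Config Λ)`. -/
abbrev Config (Λ : Finset ℤ) : Type := Λ → Fin 2

/-- The operators on `⨂_{j ∈ Λ} ℂ²`, as matrices in the product basis. Their norm is the
operator norm on the Hilbert space `EuclideanSpace ℂ (Config Λ)`. -/
abbrev Op (Λ : Finset ℤ) : Type := Matrix (Config Λ) (Config Λ) ℂ

/-- The Pauli matrix `σˣ`. -/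
def pauliX : Matrix (Fin 2) (Fin 2) ℂ := !![0, 1; 1, 0]

/-- The Pauli matrix `σʸ`. -/
def pauliY : Matrix (Fin 2) (Fin 2) ℂ := !![0, -Complex.I; Complex.I, 0]

/-- The Pauli matrix `σᶻ`. -/
def pauliZ : Matrix (Fin 2) (Fin 2) ℂ := !![1, 0; 0, -1]

/-- The operator `A_j = I ⊗ ⋯ ⊗ I ⊗ A ⊗ I ⊗ ⋯ ⊗ I` that acts by `A` on the site `j` and by the
identity on the other sites. -/
def onSite {Λ : Finset ℤ} (A : Matrix (Fin 2) (Fin 2) ℂ) (j : Λ) : Op Λ :=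
  Matrix.of fun s t => if ∀ k, k ≠ j → s k = t k then A (s j) (t j) else 0

/-- The algebra `⨂_{j ∈ S} ℂ^{2 × 2}` of observables on `S`, acting on `⨂_{j ∈ Λ} ℂ²`: it is the
algebra generated by the one-site operators at the sites in `S`. -/
def observables (Λ S : Finset ℤ) : Subalgebra ℂ (Op Λ) :=
  Algebra.adjoin ℂ {M | ∃ (j : Λ) (A : Matrix (Fin 2) (Fin 2) ℂ), (j : ℤ) ∈ S ∧ M = onSite A j}

/-- The Hamiltonian of the isotropic `XY` chain on `Λ = [m, n] ∩ ℤ` with couplings `μ` and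
fields `ν`:
`-∑_{j = m}^{n - 1} μ_j (σˣ_j σˣ_{j + 1} + σʸ_j σʸ_{j + 1}) - ∑_{j = m}^n ν_j σᶻ_j`. -/
def hamiltonian (μ ν : ℤ → ℝ) (Λ : Finset ℤ) : Op Λ :=
  - (∑ j : Λ, ∑ k : Λ, if (k : ℤ) = (j : ℤ) + 1 then
        (μ j : ℂ) • (onSite pauliX j * onSite pauliX k + onSite pauliY j * onSite pauliY k)
      else 0)
  - ∑ j : Λ, (ν j : ℂ) • onSite pauliZ j

/-- The Heisenberg evolution `τ_t(A) = e^{itH} A e^{-itH}`. -/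
def heisenberg (μ ν : ℤ → ℝ) (Λ : Finset ℤ) (t : ℝ) (A : Op Λ) : Op Λ :=
  NormedSpace.exp ((Complex.I * (t : ℂ)) • hamiltonian μ ν Λ) * A *
    NormedSpace.exp (-((Complex.I * (t : ℂ)) • hamiltonian μ ν Λ))

/-- The minimal separation `min {|n₁ - n₂| : n₁ ∈ S₁, n₂ ∈ S₂}` of two nonempty sets. -/
def separation (S₁ S₂ : Finset ℤ) : ℕ :=
  sInf {d : ℕ | ∃ n₁ ∈ S₁, ∃ n₂ ∈ S₂, d = (n₁ - n₂).natAbs}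

/-- The translate `S + a`. -/
def translate (S : Finset ℤ) (a : ℤ) : Finset ℤ := S.map (addRightEmbedding a)

/-- The chain with couplings `μ` and fields `ν` satisfies a Lieb–Robinson bound with velocity `v`,
rate `c` and prefactor `C S₁ S₂`, uniformly in the finite intervals `Λ = [m, n] ∩ ℤ`, in the
observables and in time. The prefactor may depend on the sets `S₁` and `S₂`, each taken up to
translation, so not on their relative position: a prefactor that grows with the separation of the
two sets would cancel the decay in `d`. -/
structure LiebRobinsonBound (μ ν : ℤ → ℝ) (C : Finset ℤ → Finset ℤ → ℝ) (c v : ℝ) : Prop where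
  prefactor_pos : ∀ S₁ S₂, 0 < C S₁ S₂
  prefactor_translate : ∀ S₁ S₂ a b, C (translate S₁ a) (translate S₂ b) = C S₁ S₂
  rate_pos : 0 < c
  velocity_pos : 0 < v
  bound : ∀ (m n : ℤ) (S₁ S₂ : Finset ℤ),
    S₁ ⊆ Finset.Icc m n → S₂ ⊆ Finset.Icc m n → S₁.Nonempty → S₂.Nonempty → Disjoint S₁ S₂ →
    ∀ A ∈ observables (Finset.Icc m n) S₁, ∀ B ∈ observables (Finset.Icc m n) S₂, ∀ t : ℝ,
      ‖⁅heisenberg μ ν (Finset.Icc m n) t A, B⁆‖ ≤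
        C S₁ S₂ * ‖A‖ * ‖B‖ * Real.exp (-c * ((separation S₁ S₂ : ℝ) - v * |t|))

end XYChain

end

noncomputable section

/-! ### Two-by-two matrices of determinant one -/

namespace XYChain

open Matrix

/-! The chain is tested only on the all-down state and the states with one spin up. On the latter
the Hamiltonian is a constant minus twice the Jacobi matrix `J` with hopping `μ` and field `ν`. The
all-down expectation of the commutator of `σˣ` at `0`, evolved in time, with a raising operator at
`M` is, up to a phase, an entry of the one-particle propagator. A Lieb–Robinson bound therefore
forces `|⟨0|e^{-isJ}|M⟩| ≤ C e^{-c(M - v|s|/2)}` (`LiebRobinsonBound.norm_propagator_le`), and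
translation invariance of the prefactor makes `C` independent of `M`.

Let `s` be a uniform lower bound for the measure of the spectra of good periodic approximants of
`J`, and suppose `v < s/2`. Put `w = s/4 > v/2`, `T = M/w` and `ε = c(w - v/2)`. Up to time `T` the
propagator is at most `C e^{-εT}`, so the resolvent entry between `0` and `M` at `x + iε` is of that
order up to a factor linear in `T` (`norm_resolvent_le_of_propagator`). By Cramer's rule this entry
is `1/(a_M P)`, where `P` is the upper left entry of the transfer matrix over `N = M + 1` sites, a
polynomial of degree at most `N` with real zeros. Hence `log |P(x + iε)| ≥ εN/w - o(N)`. On the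
bands of an approximant, though, `log |P(x)| = o(N)`, because periodic transfer matrices grow only
linearly there and the approximation is good enough to survive perturbation
(`norm_transfer_le_of_approximant`).

A real zero `r` contributes `½ log(1 + ε²/(x - r)²)` to `log |P(x + iε)| - log |P(x)|`, and this has
integral `πε` over the line. Integrating over the bands gives `sεN/w - o(N) ≤ πεN`
(`volume_mul_log_le`), that is, `4 ≤ π`: a contradiction. So `v ≥ s/2`
(`LiebRobinsonBound.le_velocity`).

That `s > 0` exists (`exists_le_volume_bands`) is a competition of rates. The bands of a
`q`-periodic operator have measure at least exponentially small in `q`. Passing to the next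
approximant loses at most the number of band edges times the error, and the losses decay at a faster
exponential rate. The rate `η₀` is chosen to win both this competition and the perturbation
estimate. -/

theorem norm_entry_le_l2 {n : Type*} [Fintype n] [DecidableEq n] (M : Matrix n n ℂ) (i j : n) :
    ‖M i j‖ ≤ ‖M‖ := by
  have h := Matrix.l2_opNorm_mulVec M (EuclideanSpace.single j (1 : ℂ))
  rw [PiLp.norm_single, norm_one, mul_one] at h
  refine le_trans ?_ h
  have h2 := PiLp.norm_apply_le (WithLp.toLp 2 (M *ᵥ (EuclideanSpace.single j (1 : ℂ)).ofLp)) i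
  refine le_trans (le_of_eq ?_) h2
  simp

theorem norm_fin_two_le (M : Matrix (Fin 2) (Fin 2) ℂ) :
    ‖M‖ ≤ ‖M 0 0‖ + ‖M 0 1‖ + ‖M 1 0‖ + ‖M 1 1‖ := by
  have hdiag : ∀ x y : ℂ, ‖(Matrix.diagonal ![x, y] : Matrix (Fin 2) (Fin 2) ℂ)‖ ≤ ‖x‖ + ‖y‖ := by
    intro x y
    rw [Matrix.l2_opNorm_diagonal]
    refine (pi_norm_le_iff_of_nonneg (by positivity)).2 fun i => ?_
    fin_cases i <;> simp
  have hP : ‖(!![0, 1; 1, 0] : Matrix (Fin 2) (Fin 2) ℂ)‖ ≤ 1 := by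
    have h := Matrix.l2_opNorm_conjTranspose_mul_self (!![0, 1; 1, 0] : Matrix (Fin 2) (Fin 2) ℂ)
    have h1 : (!![0, 1; 1, 0] : Matrix (Fin 2) (Fin 2) ℂ)ᴴ * !![0, 1; 1, 0] = 1 := by
      ext i j; fin_cases i <;> fin_cases j <;> simp [Matrix.mul_apply, Fin.sum_univ_two]
    rw [h1, norm_one] at h
    nlinarith [norm_nonneg (!![0, 1; 1, 0] : Matrix (Fin 2) (Fin 2) ℂ)]
  have hM : M = Matrix.diagonal ![M 0 0, M 1 1]
      + Matrix.diagonal ![M 0 1, M 1 0] * !![0, 1; 1, 0] := by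
    ext i j; fin_cases i <;> fin_cases j <;> simp [Matrix.mul_apply, Fin.sum_univ_two]
  calc ‖M‖ ≤ ‖(Matrix.diagonal ![M 0 0, M 1 1] : Matrix (Fin 2) (Fin 2) ℂ)‖
        + ‖(Matrix.diagonal ![M 0 1, M 1 0] : Matrix (Fin 2) (Fin 2) ℂ)‖
          * ‖(!![0, 1; 1, 0] : Matrix (Fin 2) (Fin 2) ℂ)‖ := by
        conv_lhs => rw [hM]
        exact (norm_add_le _ _).trans (add_le_add le_rfl (norm_mul_le _ _))
    _ ≤ (‖M 0 0‖ + ‖M 1 1‖) + (‖M 0 1‖ + ‖M 1 0‖) * 1 :=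
        add_le_add (hdiag _ _) (mul_le_mul (hdiag _ _) hP (norm_nonneg _) (by positivity))
    _ = _ := by ring

theorem norm_trace_fin_two_le (M : Matrix (Fin 2) (Fin 2) ℂ) : ‖M.trace‖ ≤ 2 * ‖M‖ := by
  rw [Matrix.trace_fin_two]
  have := norm_add_le (M 0 0) (M 1 1)
  linarith [norm_entry_le_l2 M 0 0, norm_entry_le_l2 M 1 1]

theorem adjugate_fin_two_eq (M : Matrix (Fin 2) (Fin 2) ℂ) :
    M.adjugate = M.trace • (1 : Matrix (Fin 2) (Fin 2) ℂ) - M := by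
  ext i j
  fin_cases i <;> fin_cases j <;> simp [Matrix.adjugate_fin_two, Matrix.trace_fin_two]

theorem norm_adjugate_fin_two_le (M : Matrix (Fin 2) (Fin 2) ℂ) : ‖M.adjugate‖ ≤ 3 * ‖M‖ := by
  rw [adjugate_fin_two_eq]
  refine (norm_sub_le _ _).trans ?_
  rw [norm_smul, norm_one, mul_one]
  linarith [norm_trace_fin_two_le M]

theorem exists_angle {t : ℝ} (ht : |t| ≤ 2) :
    ∃ θ : ℝ, (t : ℂ) = Complex.exp (θ * Complex.I) + Complex.exp (-(θ * Complex.I)) := by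
  refine ⟨Real.arccos (t / 2), ?_⟩
  obtain ⟨h1, h2⟩ := abs_le.1 ht
  have h : Complex.cos (Real.arccos (t / 2)) = (t / 2 : ℝ) := by
    rw [← Complex.ofReal_cos, Real.cos_arccos (by linarith) (by linarith)]
  have h2 := Complex.two_cos (Real.arccos (t / 2) : ℂ)
  rw [h] at h2
  rw [← neg_mul, ← h2]
  push_cast
  ring

theorem sq_fin_two (M : Matrix (Fin 2) (Fin 2) ℂ) (h : M.det = 1) :
    M * M = M.trace • M - 1 := by
  have := Matrix.mul_adjugate M
  rw [adjugate_fin_two_eq, h, one_smul, mul_sub, mul_smul_comm, mul_one] at this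
  rw [← this]; abel

/-- The eigenvalues `l` and `l'` are unimodular, and Cayley–Hamilton, `(M - l)(M - l') = 0`, keeps
the powers in the form `l ^ k + c (M - l)`, where `c` grows by at most one in modulus per step. This
covers the Jordan block at trace `±2` as well. -/
theorem norm_pow_le_of_trace {M : Matrix (Fin 2) (Fin 2) ℂ} (hdet : M.det = 1) {t : ℝ}
    (htr : M.trace = t) (ht : |t| ≤ 2) (k : ℕ) : ‖M ^ k‖ ≤ k * (‖M‖ + 1) + 1 := by
  obtain ⟨θ, hθ⟩ := exists_angle ht
  set l := Complex.exp (θ * Complex.I) with hl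
  set l' := Complex.exp (-(θ * Complex.I)) with hl'
  have hn : ‖l‖ = 1 := Complex.norm_exp_ofReal_mul_I θ
  have hn' : ‖l'‖ = 1 := by
    rw [hl', ← neg_mul, ← Complex.ofReal_neg]; exact Complex.norm_exp_ofReal_mul_I (-θ)
  have hll : l * l' = 1 := by rw [hl, hl', ← Complex.exp_add, add_neg_cancel, Complex.exp_zero]
  have hsq := sq_fin_two M hdet
  have key : ∀ k : ℕ, ∃ c : ℂ, ‖c‖ ≤ k ∧ M ^ k = l ^ k • 1 + c • (M - l • 1) := by
    intro k
    induction k with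
    | zero => exact ⟨0, by simp, by simp⟩
    | succ k ih =>
      obtain ⟨c, hc, hM⟩ := ih
      refine ⟨l ^ k + c * l', ?_, ?_⟩
      · refine (norm_add_le _ _).trans ?_
        rw [norm_pow, hn, norm_mul, hn']; push_cast; simp; linarith
      · rw [pow_succ, hM, add_mul, smul_mul_assoc, smul_mul_assoc, one_mul, sub_mul, hsq, htr, hθ,
          smul_mul_assoc, one_mul]
        ext i j
        simp only [Matrix.add_apply, Matrix.smul_apply, Matrix.sub_apply, smul_eq_mul]
        linear_combination (c * (1 : Matrix (Fin 2) (Fin 2) ℂ) i j) * hll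
  obtain ⟨c, hc, hM⟩ := key k
  rw [hM]
  refine (norm_add_le _ _).trans ?_
  rw [norm_smul, norm_smul, norm_pow, hn, one_pow, norm_one, one_mul, add_comm]
  refine add_le_add (mul_le_mul hc ?_ (norm_nonneg _) (by positivity)) le_rfl
  refine (norm_sub_le _ _).trans ?_
  rw [norm_smul, hn, norm_one, one_mul]

/-! ### Transfer matrices of Jacobi operators -/

/-- The one-step transfer matrix of the Jacobi equation
`a k * u (k + 1) + b k * u k + a (k - 1) * u (k - 1) = z * u k`. It maps
`(u k, a (k - 1) * u (k - 1))` to `(u (k + 1), a k * u k)`. -/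
def transferStep (a b : ℤ → ℝ) (z : ℂ) (k : ℤ) : Matrix (Fin 2) (Fin 2) ℂ :=
  !![(z - b k) / a k, -1 / a k; a k, 0]

/-- The transfer matrix of the Jacobi equation over the sites `0, …, n - 1`. -/
def transfer (a b : ℤ → ℝ) (z : ℂ) : ℕ → Matrix (Fin 2) (Fin 2) ℂ
  | 0 => 1
  | n + 1 => transferStep a b z n * transfer a b z n

variable {a b a' b' : ℤ → ℝ}

theorem transfer_succ (a b : ℤ → ℝ) (z : ℂ) (n : ℕ) :
    transfer a b z (n + 1) = transferStep a b z n * transfer a b z n := rfl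

theorem det_transfer (ha : ∀ k, 0 < a k) (z : ℂ) (n : ℕ) : (transfer a b z n).det = 1 := by
  induction n with
  | zero => simp [transfer]
  | succ n ih =>
    have : (a n : ℂ) ≠ 0 := by exact_mod_cast (ha n).ne'
    rw [transfer_succ, Matrix.det_mul, ih, transferStep, Matrix.det_fin_two_of]
    field_simp; simp

theorem exists_transfer_poly (a b : ℤ → ℝ) (n : ℕ) (i j : Fin 2) :
    ∃ p : Polynomial ℝ, p.natDegree ≤ n ∧
      ∀ z : ℂ, Polynomial.aeval z p = transfer a b z n i j := by
  induction n generalizing i j with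
  | zero =>
    refine ⟨Polynomial.C (if i = j then 1 else 0), (Polynomial.natDegree_C _).le, fun z => ?_⟩
    by_cases h : i = j <;> simp [transfer, Matrix.one_apply, h]
  | succ n ih =>
    obtain ⟨p, hp, hp'⟩ := ih 0 j
    obtain ⟨r, hr, hr'⟩ := ih 1 j
    fin_cases i
    · refine ⟨Polynomial.C (a n)⁻¹ * ((Polynomial.X - Polynomial.C (b n)) * p) -
        Polynomial.C (a n)⁻¹ * r, ?_, fun z => ?_⟩
      · refine (Polynomial.natDegree_sub_le _ _).trans (max_le ?_ ?_)
        · refine (Polynomial.natDegree_C_mul_le _ _).trans (Polynomial.natDegree_mul_le.trans ?_)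
          rw [Polynomial.natDegree_X_sub_C]; omega
        · exact (Polynomial.natDegree_C_mul_le _ _).trans (by omega)
      · simp [transfer_succ, transferStep, Matrix.mul_apply, Fin.sum_univ_two, hp', hr']
        ring
    · refine ⟨Polynomial.C (a n) * p, (Polynomial.natDegree_C_mul_le _ _).trans (by omega),
        fun z => ?_⟩
      simp [transfer_succ, transferStep, Matrix.mul_apply, Fin.sum_univ_two, hp']

theorem exists_trace_poly (a b : ℤ → ℝ) (n : ℕ) :
    ∃ p : Polynomial ℝ, p.natDegree ≤ n ∧
      ∀ x : ℝ, (transfer a b x n).trace = (p.eval x : ℝ) := by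
  obtain ⟨p, hp, hp'⟩ := exists_transfer_poly a b n 0 0
  obtain ⟨r, hr, hr'⟩ := exists_transfer_poly a b n 1 1
  refine ⟨p + r, (Polynomial.natDegree_add_le _ _).trans (max_le hp hr), fun x => ?_⟩
  rw [Matrix.trace_fin_two, ← hp', ← hr', ← map_add]
  exact Polynomial.aeval_algebraMap_apply_eq_algebraMap_eval (A := ℂ) x (p + r)

theorem transfer_add_mul {q : ℕ} (hpa : Function.Periodic a q) (hpb : Function.Periodic b q)
    (z : ℂ) (k r : ℕ) :
    transfer a b z (k * q + r) = transfer a b z r * transfer a b z q ^ k := by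
  have hstep : ∀ (k r : ℕ), transferStep a b z ((k * q + r : ℕ) : ℤ) = transferStep a b z r := by
    intro k r
    have h1 : a ((k * q + r : ℕ) : ℤ) = a r := by
      have := hpa.nat_mul k (r : ℤ)
      rw [← this]; congr 1; push_cast; ring
    have h2 : b ((k * q + r : ℕ) : ℤ) = b r := by
      have := hpb.nat_mul k (r : ℤ)
      rw [← this]; congr 1; push_cast; ring
    rw [transferStep, transferStep, h1, h2]
  have haux : ∀ (k r : ℕ), transfer a b z (k * q + r) =
      transfer a b z r * transfer a b z (k * q) := by
    intro k r
    induction r with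
    | zero => simp [transfer]
    | succ r ih => rw [← add_assoc, transfer_succ, transfer_succ, ih, hstep, mul_assoc]
  have hpow : ∀ k : ℕ, transfer a b z (k * q) = transfer a b z q ^ k := by
    intro k
    induction k with
    | zero => simp [transfer]
    | succ k ih => rw [add_mul, one_mul, haux, ih, pow_succ']
  rw [haux, hpow]

theorem norm_transfer_le_pow {κ : ℝ} {z : ℂ} (h : ∀ k, ‖transferStep a b z k‖ ≤ κ) (n : ℕ) :
    ‖transfer a b z n‖ ≤ κ ^ n := by
  induction n with
  | zero => simp [transfer]
  | succ n ih =>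
    rw [transfer_succ, pow_succ']
    exact (norm_mul_le _ _).trans
      (mul_le_mul (h n) ih (norm_nonneg _) ((norm_nonneg _).trans (h n)))

theorem norm_transfer_sub_le {κ δ : ℝ} {z z' : ℂ} (hκ : 1 ≤ κ)
    (h : ∀ k, ‖transferStep a b z k‖ ≤ κ) (h' : ∀ k, ‖transferStep a' b' z' k‖ ≤ κ)
    (hδ : ∀ k, ‖transferStep a b z k - transferStep a' b' z' k‖ ≤ δ) (n : ℕ) :
    ‖transfer a b z n - transfer a' b' z' n‖ ≤ n * κ ^ n * δ := by
  have hδ0 : 0 ≤ δ := (norm_nonneg _).trans (hδ 0)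
  induction n with
  | zero => simp [transfer]
  | succ n ih =>
    have e : transfer a b z (n + 1) - transfer a' b' z' (n + 1) =
        transferStep a b z n * (transfer a b z n - transfer a' b' z' n) +
          (transferStep a b z n - transferStep a' b' z' n) * transfer a' b' z' n := by
      rw [transfer_succ, transfer_succ, mul_sub, sub_mul]; abel
    rw [e]
    have h1 : ‖transferStep a b z n * (transfer a b z n - transfer a' b' z' n)‖ ≤
        κ * (n * κ ^ n * δ) := (norm_mul_le _ _).trans
      (mul_le_mul (h n) ih (norm_nonneg _) (by linarith))
    have h2 : ‖(transferStep a b z n - transferStep a' b' z' n) * transfer a' b' z' n‖ ≤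
        δ * κ ^ n := (norm_mul_le _ _).trans
      (mul_le_mul (hδ n) (norm_transfer_le_pow h' n) (norm_nonneg _) hδ0)
    have h3 : δ * κ ^ n ≤ δ * κ ^ (n + 1) :=
      mul_le_mul_of_nonneg_left (pow_le_pow_right₀ hκ (by omega)) hδ0
    refine (norm_add_le _ _).trans ((add_le_add h1 (h2.trans h3)).trans (le_of_eq ?_))
    push_cast; ring

/-- Variation of parameters: a transfer matrix grows at most like an unperturbed one with inverse
of comparable size. -/
theorem norm_transfer_le_of_perturbation {K δ : ℝ} {z : ℂ} {N : ℕ} (ha' : ∀ k, 0 < a' k)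
    (hK : ∀ n ≤ N, ‖transfer a' b' z n‖ ≤ K)
    (hδ : ∀ k, ‖transferStep a b z k - transferStep a' b' z k‖ ≤ δ) :
    ‖transfer a b z N‖ ≤ K * Real.exp (3 * K ^ 2 * δ * N) := by
  have hK0 : 0 ≤ K := (norm_nonneg _).trans (hK 0 (Nat.zero_le _))
  have hδ0 : 0 ≤ δ := (norm_nonneg _).trans (hδ 0)
  have hadj : ∀ n, (transfer a' b' z n).adjugate * transfer a' b' z n = 1 := fun n => by
    rw [Matrix.adjugate_mul, det_transfer ha', one_smul]
  have hadj' : ∀ n, transfer a' b' z n * (transfer a' b' z n).adjugate = 1 := fun n => by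
    rw [Matrix.mul_adjugate, det_transfer ha', one_smul]
  -- The adjugate is the inverse, since the determinant is one. The quotient `W` of the two
  -- solutions changes by `O(K ^ 2 * δ) * W` per step, so the discrete Gronwall inequality applies;
  -- the 3 comes from the bound on the adjugate.
  have hW : ∀ n ≤ N, ‖(transfer a' b' z n).adjugate * transfer a b z n‖ ≤
      Real.exp (3 * K ^ 2 * δ * n) := by
    intro n
    induction n with
    | zero => simp [transfer]
    | succ n ih =>
      intro hn
      have ih := ih (by omega)
      set W := (transfer a' b' z n).adjugate * transfer a b z n with hWdef
      have hT : transfer a b z n = transfer a' b' z n * W := by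
        rw [hWdef, ← mul_assoc, hadj', one_mul]
      have e : (transfer a' b' z (n + 1)).adjugate * transfer a b z (n + 1) =
          W + (transfer a' b' z (n + 1)).adjugate *
            ((transferStep a b z n - transferStep a' b' z n) * (transfer a' b' z n * W)) := by
        have h1 : (transfer a' b' z (n + 1)).adjugate *
            (transferStep a' b' z n * (transfer a' b' z n * W)) = W := by
          rw [← mul_assoc (transferStep a' b' z n), ← transfer_succ, ← mul_assoc, hadj, one_mul]
        rw [transfer_succ a b, hT, sub_mul, mul_sub, h1]; abel
      rw [e]
      have h1 : ‖(transfer a' b' z (n + 1)).adjugate *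
            ((transferStep a b z n - transferStep a' b' z n) * (transfer a' b' z n * W))‖ ≤
          (3 * K) * (δ * (K * ‖W‖)) := by
        refine (norm_mul_le _ _).trans (mul_le_mul ?_ ?_ (norm_nonneg _) (by positivity))
        · exact (norm_adjugate_fin_two_le _).trans (by linarith [hK (n + 1) hn])
        · refine (norm_mul_le _ _).trans (mul_le_mul (hδ n) ?_ (norm_nonneg _) hδ0)
          exact (norm_mul_le _ _).trans
            (mul_le_mul_of_nonneg_right (hK n (by omega)) (norm_nonneg _))
      calc _ ≤ ‖W‖ + (3 * K) * (δ * (K * ‖W‖)) := (norm_add_le _ _).trans (by linarith)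
        _ = (3 * K ^ 2 * δ + 1) * ‖W‖ := by ring
        _ ≤ Real.exp (3 * K ^ 2 * δ) * Real.exp (3 * K ^ 2 * δ * n) :=
            mul_le_mul (Real.add_one_le_exp _) ih (norm_nonneg _) (Real.exp_pos _).le
        _ = _ := by rw [← Real.exp_add]; push_cast; ring_nf
  have : transfer a b z N =
      transfer a' b' z N * ((transfer a' b' z N).adjugate * transfer a b z N) := by
    rw [← mul_assoc, hadj', one_mul]
  rw [this]
  exact (norm_mul_le _ _).trans (mul_le_mul (hK N le_rfl) (hW N le_rfl) (norm_nonneg _) hK0)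

/-! ### Growth of transfer matrices on the bands -/

/-- The spectral bands of the `q`-periodic Jacobi operator with coefficients `a` and `b`. -/
def bands (a b : ℤ → ℝ) (q : ℕ) : Set ℝ := {x | ‖(transfer a b x q).trace‖ ≤ 2}

/-- Whole periods cost a factor linear in their number, by `norm_pow_le_of_trace`. Only one period
and the incomplete remainder are estimated crudely, so the exponential cost is in `q` and not in the
length `n`. -/
theorem norm_transfer_le_of_mem_bands {q : ℕ} (ha : ∀ k, 0 < a k) (hq : 0 < q)
    (hpa : Function.Periodic a q) (hpb : Function.Periodic b q) {x κ : ℝ} (hκ : 1 ≤ κ)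
    (hx : x ∈ bands a b q) (h : ∀ k, ‖transferStep a b x k‖ ≤ κ) (L n : ℕ) (hn : n ≤ L * q) :
    ‖transfer a b x n‖ ≤ (2 * L + 1) * κ ^ (2 * q) := by
  obtain ⟨p, -, hp⟩ := exists_trace_poly a b q
  have hκq : 1 ≤ κ ^ q := one_le_pow₀ hκ
  have hpow : ∀ k ≤ L, ‖transfer a b x q ^ k‖ ≤ (2 * L + 1) * κ ^ q := by
    intro k hk
    have h1 := norm_pow_le_of_trace (det_transfer ha x q) (hp x)
      (by have := hx; rw [bands, Set.mem_ofPred_eq, hp, Complex.norm_real] at this; exact this) k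
    have h2 := norm_transfer_le_pow h q
    have h3 : (k : ℝ) ≤ L := by exact_mod_cast hk
    have h4 : (k : ℝ) * (‖transfer a b x q‖ + 1) ≤ L * (κ ^ q + κ ^ q) :=
      mul_le_mul h3 (by linarith) (by positivity) (by positivity)
    nlinarith
  have hr : n % q < q := Nat.mod_lt _ hq
  have hk : n / q ≤ L := by
    rw [Nat.div_le_iff_le_mul_add_pred hq]; rw [mul_comm] at hn; omega
  have hdecomp := transfer_add_mul hpa hpb (x : ℂ) (n / q) (n % q)
  rw [mul_comm, Nat.div_add_mod] at hdecomp
  rw [hdecomp]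
  have h5 : ‖transfer a b x (n % q)‖ ≤ κ ^ q :=
    (norm_transfer_le_pow h _).trans (pow_le_pow_right₀ hκ hr.le)
  calc _ ≤ κ ^ q * ((2 * L + 1) * κ ^ q) := (norm_mul_le _ _).trans
        (mul_le_mul h5 (hpow _ hk) (norm_nonneg _) (by positivity))
    _ = _ := by rw [two_mul q, pow_add]; ring

theorem norm_transferStep_le {α β R : ℝ} {k : ℤ} {z : ℂ} (hα : 0 < α) (h1 : α ≤ a k)
    (h2 : a k ≤ β) (h3 : ‖z - b k‖ ≤ R) : ‖transferStep a b z k‖ ≤ (R + 1) / α + β := by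
  have ha : 0 < a k := hα.trans_le h1
  refine (norm_fin_two_le _).trans ?_
  have e1 : ‖(z - b k) / a k‖ ≤ R / α := by
    rw [norm_div, Complex.norm_real, Real.norm_of_nonneg ha.le]
    exact div_le_div₀ ((norm_nonneg _).trans h3) h3 hα h1
  have e2 : ‖(-1 : ℂ) / a k‖ ≤ 1 / α := by
    rw [norm_div, Complex.norm_real, Real.norm_of_nonneg ha.le, norm_neg, norm_one]
    exact div_le_div₀ zero_le_one le_rfl hα h1
  have e3 : ‖(a k : ℂ)‖ ≤ β := by rwa [Complex.norm_real, Real.norm_of_nonneg ha.le]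
  simp only [transferStep, Matrix.of_apply, Matrix.cons_val', Matrix.cons_val_zero,
    Matrix.cons_val_one, Matrix.cons_val_fin_one, norm_zero, add_zero]
  rw [add_div]; linarith

theorem norm_transferStep_sub_le {α R δ : ℝ} {k : ℤ} {z z' : ℂ} (hα : 0 < α) (h1 : α ≤ a k)
    (h1' : α ≤ a' k) (h3 : ‖z - b k‖ ≤ R) (ha : |a k - a' k| ≤ δ)
    (hb : ‖(z - b k) - (z' - b' k)‖ ≤ δ) :
    ‖transferStep a b z k - transferStep a' b' z' k‖ ≤ ((R + 1) / α ^ 2 + 1 / α + 1) * δ := by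
  have ha0 : 0 < a k := hα.trans_le h1
  have ha0' : 0 < a' k := hα.trans_le h1'
  have hR : 0 ≤ R := (norm_nonneg _).trans h3
  have hδ : 0 ≤ δ := (abs_nonneg _).trans ha
  have c0 : (a k : ℂ) ≠ 0 := by exact_mod_cast ha0.ne'
  have c0' : (a' k : ℂ) ≠ 0 := by exact_mod_cast ha0'.ne'
  have hinv : ‖1 / (a k : ℂ) - 1 / a' k‖ ≤ δ / α ^ 2 := by
    have : 1 / (a k : ℂ) - 1 / a' k = ((a' k - a k) / (a k * a' k) : ℝ) := by
      push_cast; field_simp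
    rw [this, Complex.norm_real, Real.norm_eq_abs, abs_div, abs_sub_comm, abs_of_pos
      (mul_pos ha0 ha0')]
    exact div_le_div₀ hδ ha (by positivity)
      (by rw [sq]; exact mul_le_mul h1 h1' hα.le ha0.le)
  have hinv' : ‖1 / (a' k : ℂ)‖ ≤ 1 / α := by
    rw [norm_div, Complex.norm_real, Real.norm_of_nonneg ha0'.le, norm_one]
    exact div_le_div₀ zero_le_one le_rfl hα h1'
  refine (norm_fin_two_le _).trans ?_
  simp only [transferStep, Matrix.sub_apply, Matrix.of_apply, Matrix.cons_val',
    Matrix.cons_val_zero, Matrix.cons_val_one, Matrix.cons_val_fin_one, sub_zero, norm_zero,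
    add_zero]
  have e1 : ‖(z - b k) / a k - (z' - b' k) / a' k‖ ≤ R * (δ / α ^ 2) + δ * (1 / α) := by
    have : (z - b k) / a k - (z' - b' k) / a' k = (z - b k) * (1 / (a k : ℂ) - 1 / a' k) +
        ((z - b k) - (z' - b' k)) * (1 / a' k) := by ring
    rw [this]
    refine (norm_add_le _ _).trans ?_
    rw [norm_mul, norm_mul]
    exact add_le_add (mul_le_mul h3 hinv (norm_nonneg _) hR)
      (mul_le_mul hb hinv' (norm_nonneg _) hδ)
  have e2 : ‖(-1 : ℂ) / a k - -1 / a' k‖ ≤ δ / α ^ 2 := by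
    have : (-1 : ℂ) / a k - -1 / a' k = -(1 / (a k : ℂ) - 1 / a' k) := by ring
    rwa [this, norm_neg]
  have e3 : ‖(a k : ℂ) - a' k‖ ≤ δ := by
    rw [← Complex.ofReal_sub, Complex.norm_real]; exact ha
  refine (add_le_add (add_le_add e1 e2) e3).trans (le_of_eq ?_)
  have hα' := hα.ne'
  field_simp
  ring

end XYChain

/-! ### Floquet theory on a ring -/

namespace XYChain

open Matrix

variable {a b a' b' : ℤ → ℝ}

/-- In an orthonormal eigenbasis `A - x` multiplies coordinates by `λ - x`; were all these factors
larger than `r` in modulus, so would be the quotient of the norms. -/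
theorem exists_eigenvalue_near {n : Type*} [Fintype n] [DecidableEq n] {A : Matrix n n ℂ}
    (hA : A.IsHermitian) {x r : ℝ} {v : EuclideanSpace ℂ n} (hv : v ≠ 0)
    (h : ‖WithLp.toLp 2 (A *ᵥ v.ofLp) - (x : ℂ) • v‖ ≤ r * ‖v‖) :
    ∃ y : ℝ, |x - y| ≤ r ∧ ∃ w : n → ℂ, w ≠ 0 ∧ A *ᵥ w = (y : ℂ) • w := by
  suffices hs : ∃ i, |x - hA.eigenvalues i| ≤ r by
    obtain ⟨i, hi⟩ := hs
    refine ⟨_, hi, (hA.eigenvectorBasis i).ofLp, ?_, ?_⟩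
    · have := hA.eigenvectorBasis.orthonormal.ne_zero i
      intro h0
      exact this (by ext j; exact congrFun h0 j)
    · rw [hA.mulVec_eigenvectorBasis]; rfl
  by_contra! hcon
  have hcoord : ∀ i, inner ℂ (hA.eigenvectorBasis i) (WithLp.toLp 2 (A *ᵥ v.ofLp) - (x : ℂ) • v) =
      ((hA.eigenvalues i - x : ℝ) : ℂ) * inner ℂ (hA.eigenvectorBasis i) v := by
    intro i
    rw [inner_sub_right, inner_smul_right]
    have h1 : inner ℂ (hA.eigenvectorBasis i) (WithLp.toLp 2 (A *ᵥ v.ofLp)) =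
        (hA.eigenvalues i : ℂ) * inner ℂ (hA.eigenvectorBasis i) v := by
      have h2 := Matrix.isSymmetric_toEuclideanLin_iff.2 hA (hA.eigenvectorBasis i) v
      have h3 : Matrix.toEuclideanLin A (hA.eigenvectorBasis i) =
          (hA.eigenvalues i : ℂ) • hA.eigenvectorBasis i := by
        ext j
        have := congrFun (hA.mulVec_eigenvectorBasis i) j
        simpa [Matrix.toLpLin_apply] using this
      rw [h3, inner_smul_left, Complex.conj_ofReal] at h2
      rw [h2]
      rfl
    rw [h1]; push_cast; ring
  have hr : 0 ≤ r := by
    by_contra hr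
    have : 0 < ‖v‖ := norm_pos_iff.2 hv
    nlinarith [norm_nonneg (WithLp.toLp 2 (A *ᵥ v.ofLp) - (x : ℂ) • v)]
  have e1 := hA.eigenvectorBasis.sum_sq_norm_inner_right (WithLp.toLp 2 (A *ᵥ v.ofLp) - (x : ℂ) • v)
  have e2 := hA.eigenvectorBasis.sum_sq_norm_inner_right v
  have hlt : r ^ 2 * ‖v‖ ^ 2 < ‖WithLp.toLp 2 (A *ᵥ v.ofLp) - (x : ℂ) • v‖ ^ 2 := by
    rw [← e1, ← e2, Finset.mul_sum]
    have hle : ∀ i, r ^ 2 < (hA.eigenvalues i - x) ^ 2 := by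
      intro i
      have := hcon i
      rw [abs_sub_comm] at this
      rw [← sq_abs (hA.eigenvalues i - x)]
      nlinarith
    refine Finset.sum_lt_sum (fun i _ => ?_) ?_
    · rw [hcoord, norm_mul, Complex.norm_real, mul_pow, Real.norm_eq_abs, sq_abs]
      exact mul_le_mul_of_nonneg_right (hle i).le (by positivity)
    · by_contra! hall
      apply hv
      rw [← norm_eq_zero, ← sq_eq_zero_iff, ← e2]
      refine Finset.sum_eq_zero fun i hi => ?_
      have := hall i hi
      rw [hcoord, norm_mul, Complex.norm_real, mul_pow, Real.norm_eq_abs, sq_abs] at this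
      nlinarith [hle i, sq_nonneg ‖inner ℂ (hA.eigenvectorBasis i) v‖]
  have : ‖WithLp.toLp 2 (A *ᵥ v.ofLp) - (x : ℂ) • v‖ ^ 2 ≤ (r * ‖v‖) ^ 2 := by gcongr
  rw [mul_pow] at this
  linarith

/-- The shift on the ring `ℤ / N`. -/
def ringShift (N : ℕ) : Matrix (ZMod N) (ZMod N) ℂ :=
  Matrix.of fun j k => if k = j + 1 then 1 else 0

/-- The Jacobi matrix on the ring `ℤ / N`, with magnetic flux `N * φ` through the ring. -/
def ringMatrix (N : ℕ) [NeZero N] (a b : ℤ → ℝ) (φ : ℝ) : Matrix (ZMod N) (ZMod N) ℂ :=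
  Complex.exp (φ * Complex.I) •
      (Matrix.diagonal (fun k : ZMod N => ((a (k.val : ℤ) : ℝ) : ℂ)) * ringShift N) +
    (Complex.exp (φ * Complex.I) •
      (Matrix.diagonal (fun k : ZMod N => ((a (k.val : ℤ) : ℝ) : ℂ)) * ringShift N))ᴴ +
    Matrix.diagonal (fun k : ZMod N => ((b (k.val : ℤ) : ℝ) : ℂ))

theorem isHermitian_ringMatrix (N : ℕ) [NeZero N] (a b : ℤ → ℝ) (φ : ℝ) :
    (ringMatrix N a b φ).IsHermitian := by
  unfold ringMatrix
  refine (Matrix.isHermitian_add_transpose_self _).add ?_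
  refine Matrix.isHermitian_diagonal_of_self_adjoint _ ?_
  ext k; simp

theorem norm_ringShift_le (N : ℕ) [NeZero N] : ‖ringShift N‖ ≤ 1 := by
  have h := Matrix.l2_opNorm_conjTranspose_mul_self (ringShift N)
  have h1 : (ringShift N)ᴴ * ringShift N = 1 := by
    ext i j
    rw [Matrix.mul_apply, Finset.sum_eq_single (i - 1)]
    · by_cases hij : i = j
      · subst hij; simp [ringShift]
      · simp [ringShift, hij, Ne.symm hij]
    · intro k _ hk
      have : i ≠ k + 1 := fun h => hk (by rw [h]; ring)
      simp [ringShift, this]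
    · simp
  rw [h1, norm_one] at h
  nlinarith [norm_nonneg (ringShift N)]

theorem norm_ringMatrix_le (N : ℕ) [NeZero N] {α β : ℝ} (ha : ∀ k, |a k| ≤ α)
    (hb : ∀ k, |b k| ≤ β) (φ : ℝ) : ‖ringMatrix N a b φ‖ ≤ 2 * α + β := by
  have hdiag : ∀ {c : ℤ → ℝ} {γ : ℝ}, (∀ k, |c k| ≤ γ) →
      ‖(Matrix.diagonal (fun k : ZMod N => ((c (k.val : ℤ) : ℝ) : ℂ)))‖ ≤ γ := by
    intro c γ hc
    rw [Matrix.l2_opNorm_diagonal]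
    refine (pi_norm_le_iff_of_nonneg ((abs_nonneg _).trans (hc 0))).2 fun i => ?_
    rw [Complex.norm_real]; exact hc _
  have hα : 0 ≤ α := (abs_nonneg _).trans (ha 0)
  have h1 : ‖Complex.exp (φ * Complex.I) •
      (Matrix.diagonal (fun k : ZMod N => ((a (k.val : ℤ) : ℝ) : ℂ)) * ringShift N)‖ ≤ α := by
    rw [norm_smul, Complex.norm_exp_ofReal_mul_I, one_mul]
    refine (norm_mul_le _ _).trans ?_
    calc _ ≤ α * 1 := mul_le_mul (hdiag ha) (norm_ringShift_le N) (norm_nonneg _) hα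
      _ = α := mul_one α
  unfold ringMatrix
  refine (norm_add_le _ _).trans (add_le_add ((norm_add_le _ _).trans ?_) (hdiag hb))
  rw [Matrix.l2_opNorm_conjTranspose]
  linarith

theorem ringMatrix_sub (N : ℕ) [NeZero N] (a b a' b' : ℤ → ℝ) (φ : ℝ) :
    ringMatrix N a b φ - ringMatrix N a' b' φ = ringMatrix N (a - a') (b - b') φ := by
  have hd : ∀ c d : ℤ → ℝ,
      Matrix.diagonal (fun k : ZMod N => (((c - d) (k.val : ℤ) : ℝ) : ℂ)) =
      Matrix.diagonal (fun k : ZMod N => ((c (k.val : ℤ) : ℝ) : ℂ)) -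
        Matrix.diagonal (fun k : ZMod N => ((d (k.val : ℤ) : ℝ) : ℂ)) := by
    intro c d; rw [Matrix.diagonal_sub]; simp
  unfold ringMatrix
  rw [hd, hd, sub_mul, smul_sub, Matrix.conjTranspose_sub]
  abel

/-- The two hops are separate summands, so the formula stays correct for `N = 1` and `N = 2`, where
the neighbours coincide. -/
theorem ringMatrix_mulVec (N : ℕ) [NeZero N] (a b : ℤ → ℝ) (φ : ℝ) (w : ZMod N → ℂ)
    (k : ZMod N) :
    (ringMatrix N a b φ *ᵥ w) k = a k.val * Complex.exp (φ * Complex.I) * w (k + 1) +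
      b k.val * w k + a (k - 1).val * Complex.exp (-(φ * Complex.I)) * w (k - 1) := by
  have hc : (starRingEnd ℂ) (Complex.exp (φ * Complex.I)) = Complex.exp (-(φ * Complex.I)) := by
    rw [← Complex.exp_conj]; simp
  have hS : ∀ v : ZMod N → ℂ, ∀ k, (ringShift N *ᵥ v) k = v (k + 1) := by
    intro v k
    simp [ringShift, Matrix.mulVec, dotProduct]
  have hS' : ∀ v : ZMod N → ℂ, ∀ k, ((ringShift N)ᴴ *ᵥ v) k = v (k - 1) := by
    intro v k
    rw [Matrix.mulVec, dotProduct, Finset.sum_eq_single (k - 1)]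
    · simp [ringShift]
    · intro j _ hj
      have : k ≠ j + 1 := fun h => hj (by rw [h]; ring)
      simp [ringShift, this]
    · simp
  unfold ringMatrix
  rw [Matrix.conjTranspose_smul, Matrix.conjTranspose_mul, Matrix.diagonal_conjTranspose,
    Matrix.add_mulVec, Matrix.add_mulVec, Matrix.smul_mulVec, Matrix.smul_mulVec,
    ← Matrix.mulVec_mulVec, ← Matrix.mulVec_mulVec]
  simp only [Pi.add_apply, Pi.smul_apply, Matrix.mulVec_diagonal, hS, hS', smul_eq_mul,
    Pi.star_apply, RCLike.star_def, hc, Complex.conj_ofReal]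
  ring

theorem periodic_emod {α : Type*} {c : ℤ → α} {N : ℕ} (hc : Function.Periodic c N) (k : ℤ) :
    c (k % N) = c k := by
  rw [Int.emod_def, mul_comm]
  exact hc.sub_int_mul_eq _

theorem periodic_val_intCast {α : Type*} {c : ℤ → α} {N : ℕ} [NeZero N]
    (hc : Function.Periodic c N) (k : ℤ) : c ((k : ZMod N).val : ℤ) = c k := by
  rw [ZMod.val_intCast, periodic_emod hc]

theorem periodic_of_dvd {α : Type*} {c : ℤ → α} {q N : ℕ} (hc : Function.Periodic c q)
    (h : q ∣ N) : Function.Periodic c N := by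
  obtain ⟨m, rfl⟩ := h
  have := hc.nat_mul m
  intro k
  rw [← this k]; push_cast; ring_nf

/-- The flux is gauged away: `l ^ k * w k` solves the Jacobi equation on the whole line and picks up
the factor `l ^ N` around the ring. -/
theorem exists_transfer_of_ringMatrix_eigenvector {N : ℕ} [NeZero N] (ha : ∀ k, 0 < a k)
    (hpa : Function.Periodic a N) (hpb : Function.Periodic b N) {φ : ℝ} {x : ℂ}
    {w : ZMod N → ℂ} (hw : w ≠ 0) (h : ringMatrix N a b φ *ᵥ w = x • w) :
    ∃ v : Fin 2 → ℂ, v ≠ 0 ∧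
      transfer a b x N *ᵥ v = Complex.exp (φ * Complex.I) ^ N • v := by
  set l := Complex.exp (φ * Complex.I) with hl
  have hl0 : l ≠ 0 := Complex.exp_ne_zero _
  have hlinv : Complex.exp (-(φ * Complex.I)) = l⁻¹ := Complex.exp_neg _
  set u : ℤ → ℂ := fun k => l ^ k * w (k : ZMod N) with hu
  have hueq : ∀ k : ℤ, a k * u (k + 1) = (x - b k) * u k - a (k - 1) * u (k - 1) := by
    intro k
    have h1 := congrFun h (k : ZMod N)
    rw [ringMatrix_mulVec, hlinv, Pi.smul_apply, smul_eq_mul, periodic_val_intCast hpa,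
      periodic_val_intCast hpb] at h1
    have h2 : a (((k : ZMod N) - 1).val : ℤ) = a (k - 1) := by
      rw [← periodic_val_intCast hpa (k - 1)]; push_cast; rfl
    rw [h2] at h1
    simp only [hu]
    push_cast
    rw [zpow_add_one₀ hl0, zpow_sub_one₀ hl0]
    linear_combination (l ^ k) * h1
  set Y : ℕ → Fin 2 → ℂ := fun n => ![u n, a (n - 1) * u (n - 1)] with hY
  have hYT : ∀ n : ℕ, Y n = transfer a b x n *ᵥ Y 0 := by
    intro n
    induction n with
    | zero => simp [transfer]
    | succ n ih =>
      rw [transfer_succ, ← Matrix.mulVec_mulVec, ← ih]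
      have hne : (a n : ℂ) ≠ 0 := by exact_mod_cast (ha n).ne'
      have := hueq n
      ext i
      fin_cases i
      · simp [hY, transferStep, Matrix.mulVec, dotProduct, Fin.sum_univ_two]
        field_simp
        linear_combination this
      · simp [hY, transferStep, Matrix.mulVec, dotProduct, Fin.sum_univ_two]
  refine ⟨Y 0, fun h0 => hw ?_, ?_⟩
  · ext k
    have h1 := hYT k.val
    rw [h0, Matrix.mulVec_zero] at h1
    have h2 := congrFun h1 0
    have h3 : l ^ (k.val : ℤ) ≠ 0 := zpow_ne_zero _ hl0
    simpa [hY, hu, hl0] using h2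
  · rw [← hYT]
    have hper : ∀ k : ℤ, u (N + k) = l ^ N * u k := by
      intro k
      simp only [hu]
      rw [zpow_add₀ hl0]; push_cast
      rw [ZMod.natCast_self, zero_add, zpow_natCast]; ring
    have h1 := hper 0
    have h2 := hper (-1)
    have h3 : a (N - 1) = a (-1) := by rw [← hpa (-1)]; ring_nf
    ext i
    fin_cases i
    · simpa [hY] using h1
    · simp [hY, h3]
      rw [show (N : ℤ) - 1 = N + -1 by ring, h2]; ring

/-- The orbit `T ^ k v` has periodic norm, hence a largest term. Cayley–Hamilton reads `tr T • y k =
y (k + 1) + y (k - 1)`, which at the largest term gives `|tr T| ≤ 2`. -/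
theorem mem_bands_of_ringMatrix_eigenvector {N q : ℕ} [NeZero N] (hqN : q ∣ N)
    (ha : ∀ k, 0 < a k) (hpa : Function.Periodic a q) (hpb : Function.Periodic b q) {φ x : ℝ}
    {w : ZMod N → ℂ} (hw : w ≠ 0) (h : ringMatrix N a b φ *ᵥ w = (x : ℂ) • w) :
    x ∈ bands a b q := by
  obtain ⟨v, hv, hTv⟩ := exists_transfer_of_ringMatrix_eigenvector ha (periodic_of_dvd hpa hqN)
    (periodic_of_dvd hpb hqN) hw h
  obtain ⟨m, hm⟩ := hqN
  have hm0 : 0 < m := by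
    rcases Nat.eq_zero_or_pos m with h0 | h0
    · exact absurd (by simp [hm, h0]) (NeZero.ne N)
    · exact h0
  set T := transfer a b x q with hT
  have hTN : transfer a b x N = T ^ m := by
    have := transfer_add_mul hpa hpb (x : ℂ) m 0
    simpa [transfer, hm, mul_comm] using this
  rw [hTN] at hTv
  set y : ℕ → EuclideanSpace ℂ (Fin 2) := fun k => WithLp.toLp 2 (T ^ k *ᵥ v) with hy
  have hyper : ∀ k, ‖y (k + m)‖ = ‖y k‖ := by
    intro k
    simp only [hy]
    rw [pow_add, ← Matrix.mulVec_mulVec, hTv, Matrix.mulVec_smul, WithLp.toLp_smul, norm_smul,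
      norm_pow, Complex.norm_exp_ofReal_mul_I, one_pow, one_mul]
  have hymod : ∀ k, ‖y k‖ = ‖y (k % m)‖ := fun k =>
    ((show Function.Periodic (fun k => ‖y k‖) m from hyper).map_mod_nat k).symm
  obtain ⟨i, hi, hmax⟩ := Finset.exists_max_image (Finset.range m) (fun k => ‖y k‖)
    ⟨0, Finset.mem_range.2 hm0⟩
  have hmax' : ∀ k, ‖y k‖ ≤ ‖y i‖ := fun k => by
    rw [hymod]; exact hmax _ (Finset.mem_range.2 (Nat.mod_lt _ hm0))
  have hpos : 0 < ‖y i‖ := by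
    refine lt_of_lt_of_le (norm_pos_iff.2 fun h0 => hv ?_) (hmax' 0)
    have : T ^ 0 *ᵥ v = 0 := congrArg WithLp.ofLp h0
    simpa using this
  -- The index is moved up by one period so that it has a predecessor in `ℕ`.
  have hrec : T.trace • y (i + m) = y (i + m + 1) + y (i + m - 1) := by
    obtain ⟨p, hp⟩ : ∃ p, i + m = p + 1 := ⟨i + m - 1, by omega⟩
    rw [hp, Nat.add_sub_cancel]
    simp only [hy]
    rw [← WithLp.toLp_smul, ← WithLp.toLp_add, ← Matrix.smul_mulVec, ← Matrix.add_mulVec]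
    congr 2
    have := sq_fin_two T (det_transfer ha _ _)
    rw [pow_succ T (p + 1), pow_succ T p, mul_assoc, this, mul_sub, mul_one, sub_add_cancel,
      mul_smul_comm]
  have h1 : ‖T.trace‖ * ‖y i‖ ≤ ‖y i‖ + ‖y i‖ := by
    rw [← hyper i, ← norm_smul, hrec, hyper i]
    exact (norm_add_le _ _).trans (add_le_add (hmax' _) (hmax' _))
  show ‖T.trace‖ ≤ 2
  nlinarith

/-- On a band the trace is `l ^ q + l ^ (-q)` with `l` unimodular, so `l ^ q` is an eigenvalue of
the monodromy. The corresponding solution divided by `l ^ n` is `q`-periodic: a Bloch wave, which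
lives on every ring whose length is a multiple of `q`. -/
theorem exists_ringMatrix_eigenvector {N q : ℕ} [NeZero N] (hq : 0 < q) (hqN : q ∣ N)
    (ha : ∀ k, 0 < a k) (hpa : Function.Periodic a q) (hpb : Function.Periodic b q) {x : ℝ}
    (hx : x ∈ bands a b q) :
    ∃ (φ : ℝ) (w : ZMod N → ℂ), w ≠ 0 ∧ ringMatrix N a b φ *ᵥ w = (x : ℂ) • w := by
  set T := transfer a b x q with hT
  obtain ⟨p, -, hp⟩ := exists_trace_poly a b q
  have hx' : |p.eval x| ≤ 2 := by
    have := hx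
    rwa [bands, Set.mem_ofPred_eq, hp, Complex.norm_real] at this
  obtain ⟨θ, hθ⟩ := exists_angle hx'
  rw [← hp] at hθ
  set l := Complex.exp ((θ / q : ℝ) * Complex.I) with hl
  have hl0 : l ≠ 0 := Complex.exp_ne_zero _
  have hlinv : Complex.exp (-((θ / q : ℝ) * Complex.I)) = l⁻¹ := Complex.exp_neg _
  have hlq : l ^ q = Complex.exp (θ * Complex.I) := by
    rw [hl, ← Complex.exp_nat_mul]; congr 1; push_cast
    have : (q : ℂ) ≠ 0 := by exact_mod_cast hq.ne'
    field_simp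
  rw [Complex.exp_neg, ← hlq] at hθ
  have hdet : (T - l ^ q • 1).det = 0 := by
    have h1 : T.det = 1 := det_transfer ha _ _
    rw [Matrix.det_fin_two] at h1 ⊢
    have h2 : T 0 0 + T 1 1 = l ^ q + (l ^ q)⁻¹ := by rw [← hθ, Matrix.trace_fin_two]
    have h3 : l ^ q * (l ^ q)⁻¹ = 1 := mul_inv_cancel₀ (pow_ne_zero _ hl0)
    simp
    linear_combination h1 - l ^ q * h2 - h3
  obtain ⟨v, hv, hv0⟩ := Matrix.exists_mulVec_eq_zero_iff.2 hdet
  rw [Matrix.sub_mulVec, Matrix.smul_mulVec, Matrix.one_mulVec, sub_eq_zero] at hv0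
  set f : ℕ → ℂ := fun n => (transfer a b x n *ᵥ v) 0 with hf
  set g : ℕ → ℂ := fun n => (transfer a b x n *ᵥ v) 1 with hg
  have hfs : ∀ n : ℕ, a n * f (n + 1) = (x - b n) * f n - g n := by
    intro n
    have hne : (a n : ℂ) ≠ 0 := by exact_mod_cast (ha n).ne'
    simp only [hf, hg, transfer_succ]
    rw [← Matrix.mulVec_mulVec, Matrix.mulVec, dotProduct, Fin.sum_univ_two]
    simp [transferStep]
    field_simp
    ring
  have hgs : ∀ n : ℕ, g (n + 1) = a n * f n := by
    intro n
    simp only [hf, hg, transfer_succ]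
    rw [← Matrix.mulVec_mulVec, Matrix.mulVec, dotProduct, Fin.sum_univ_two]
    simp [transferStep]
  have hfq : ∀ n, f (n + q) = l ^ q * f n := by
    intro n
    have := transfer_add_mul hpa hpb (x : ℂ) 1 n
    simp only [hf]
    rw [add_comm n q, ← one_mul q, this, pow_one, ← Matrix.mulVec_mulVec, one_mul, hv0,
      Matrix.mulVec_smul]
    rfl
  set c : ℕ → ℂ := fun n => (l ^ n)⁻¹ * f n with hc
  have hcN : Function.Periodic c N := by
    have hcq : Function.Periodic c q := by
      intro n
      simp only [hc]
      rw [hfq, pow_add]; field_simp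
    obtain ⟨m, rfl⟩ := hqN
    rw [mul_comm]
    exact hcq.nat_mul m
  have hfc : ∀ n, f n = l ^ n * c n := fun n => by
    simp only [hc]; field_simp
  have hcv : ∀ n : ℕ, c ((n : ZMod N).val) = c n := fun n => by
    rw [ZMod.val_natCast]; exact hcN.map_mod_nat n
  refine ⟨θ / q, fun k => c k.val, fun h0 => hv ?_, ?_⟩
  · have hf0 : ∀ n, f n = 0 := fun n => by
      rw [hfc, ← hcv n, show c ((n : ZMod N).val) = 0 from congrFun h0 _, mul_zero]
    have h1 := hfs 0
    rw [hf0, hf0] at h1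
    ext i
    fin_cases i
    · simpa [hf, transfer] using hf0 0
    · simpa [hg, transfer] using h1
  · have hpaN := periodic_of_dvd hpa hqN
    have hpbN := periodic_of_dvd hpb hqN
    have hav : ∀ n : ℕ, a ((n : ZMod N).val : ℤ) = a n := fun n => by
      have := periodic_val_intCast hpaN (n : ℤ); push_cast at this; exact this
    have hbv : ∀ n : ℕ, b ((n : ZMod N).val : ℤ) = b n := fun n => by
      have := periodic_val_intCast hpbN (n : ℤ); push_cast at this; exact this
    ext k
    obtain ⟨m, rfl⟩ : ∃ m : ℕ, k = ((m + 1 : ℕ) : ZMod N) :=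
      ⟨(k - 1).val, by push_cast; rw [ZMod.natCast_zmod_val]; ring⟩
    rw [ringMatrix_mulVec, hlinv, Pi.smul_apply, smul_eq_mul, hav, hbv]
    have e1 : ((m + 1 : ℕ) : ZMod N) + 1 = ((m + 2 : ℕ) : ZMod N) := by push_cast; ring
    have e2 : ((m + 1 : ℕ) : ZMod N) - 1 = ((m : ℕ) : ZMod N) := by push_cast; ring
    rw [e1, e2, hav, hcv, hcv, hcv]
    have h1 := hfs (m + 1)
    rw [hgs, hfc (m + 1 + 1), hfc (m + 1), hfc m] at h1
    have hlm : l ^ (m + 1) ≠ 0 := pow_ne_zero _ hl0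
    apply mul_left_cancel₀ hlm
    have h2 : l ^ (m + 1) * l⁻¹ = l ^ m := by rw [pow_succ]; field_simp
    rw [pow_succ l (m + 1)] at h1
    linear_combination h1 + (a m : ℂ) * c m * h2

theorem abs_le_of_mem_bands {q : ℕ} (hq : 0 < q) (ha : ∀ k, 0 < a k)
    (hpa : Function.Periodic a q) (hpb : Function.Periodic b q) {α β x : ℝ} (hα : ∀ k, |a k| ≤ α)
    (hβ : ∀ k, |b k| ≤ β) (hx : x ∈ bands a b q) : |x| ≤ 2 * α + β := by
  have : NeZero q := ⟨hq.ne'⟩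
  obtain ⟨φ, w, hw, h⟩ := exists_ringMatrix_eigenvector (N := q) hq dvd_rfl ha hpa hpb hx
  have h1 := Matrix.l2_opNorm_mulVec (ringMatrix q a b φ) (WithLp.toLp 2 w)
  have hpos : 0 < ‖WithLp.toLp 2 w‖ := norm_pos_iff.2 fun h0 => hw (by
    ext j; exact congrArg (fun z : EuclideanSpace ℂ (ZMod q) => z j) h0)
  change ‖WithLp.toLp 2 (ringMatrix q a b φ *ᵥ w)‖ ≤ _ at h1
  rw [h, WithLp.toLp_smul, norm_smul, Complex.norm_real, Real.norm_eq_abs] at h1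
  exact (le_of_mul_le_mul_right h1 hpos).trans (norm_ringMatrix_le q hα hβ φ)

/-- Both operators are put on a common ring of length `q * q'` with the same flux. There the Bloch
wave of one is an approximate eigenvector of the other, with error at most the norm of the
difference: `2 * δ` from hopping and `δ` from the field. -/
theorem exists_mem_bands_near {q q' : ℕ} (hq : 0 < q) (hq' : 0 < q') (ha : ∀ k, 0 < a k)
    (hpa : Function.Periodic a q) (hpb : Function.Periodic b q) (ha' : ∀ k, 0 < a' k)
    (hpa' : Function.Periodic a' q') (hpb' : Function.Periodic b' q') {δ x : ℝ}
    (hδa : ∀ k, |a k - a' k| ≤ δ) (hδb : ∀ k, |b k - b' k| ≤ δ) (hx : x ∈ bands a b q) :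
    ∃ y ∈ bands a' b' q', |x - y| ≤ 3 * δ := by
  have : NeZero (q * q') := ⟨(Nat.mul_pos hq hq').ne'⟩
  obtain ⟨φ, w, hw, h⟩ :=
    exists_ringMatrix_eigenvector (N := q * q') hq (dvd_mul_right _ _) ha hpa hpb hx
  have h1 : ‖WithLp.toLp 2 (ringMatrix (q * q') a' b' φ *ᵥ w) - (x : ℂ) • WithLp.toLp 2 w‖ ≤
      3 * δ * ‖WithLp.toLp 2 w‖ := by
    rw [← WithLp.toLp_smul, ← h, ← WithLp.toLp_sub, ← Matrix.sub_mulVec, ringMatrix_sub]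
    refine (Matrix.l2_opNorm_mulVec _ (WithLp.toLp 2 w)).trans ?_
    refine mul_le_mul_of_nonneg_right ?_ (norm_nonneg _)
    refine (norm_ringMatrix_le _ (α := δ) (β := δ) ?_ ?_ φ).trans (by linarith)
    · intro k; rw [Pi.sub_apply, abs_sub_comm]; exact hδa k
    · intro k; rw [Pi.sub_apply, abs_sub_comm]; exact hδb k
  have hw' : WithLp.toLp 2 w ≠ 0 := fun h0 => hw (by
    ext j; exact congrArg (fun z : EuclideanSpace ℂ (ZMod (q * q')) => z j) h0)
  obtain ⟨y, hy, u, hu, hyu⟩ := exists_eigenvalue_near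
    (isHermitian_ringMatrix (q * q') a' b' φ) hw' h1
  exact ⟨y, mem_bands_of_ringMatrix_eigenvector (dvd_mul_left _ _) ha' hpa' hpb' hu hyu, hy⟩

/-- The flux is chosen so that one turn multiplies by `I`; the monodromy then has eigenvalues `I`
and `-I`, as its determinant is one. -/
theorem exists_trace_transfer_eq_zero {q : ℕ} (hq : 0 < q) (ha : ∀ k, 0 < a k)
    (hpa : Function.Periodic a q) (hpb : Function.Periodic b q) :
    ∃ x : ℝ, (transfer a b x q).trace = 0 := by
  have : NeZero q := ⟨hq.ne'⟩
  set φ : ℝ := Real.pi / 2 / q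
  have hA := isHermitian_ringMatrix q a b φ
  have i : ZMod q := 0
  have hw : (hA.eigenvectorBasis i).ofLp ≠ 0 := fun h0 =>
    hA.eigenvectorBasis.orthonormal.ne_zero i (by ext j; exact congrFun h0 j)
  obtain ⟨v, hv, hTv⟩ := exists_transfer_of_ringMatrix_eigenvector ha hpa hpb
    (x := (hA.eigenvalues i : ℂ)) hw (hA.mulVec_eigenvectorBasis i)
  refine ⟨hA.eigenvalues i, ?_⟩
  have hI : Complex.exp (φ * Complex.I) ^ q = Complex.I := by
    rw [← Complex.exp_nat_mul]
    have : (q : ℂ) ≠ 0 := by exact_mod_cast hq.ne'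
    have h2 : (q : ℂ) * (φ * Complex.I) = Real.pi / 2 * Complex.I := by
      simp only [φ]; push_cast; field_simp
    rw [h2, Complex.exp_pi_div_two_mul_I]
  rw [hI] at hTv
  set T := transfer a b (hA.eigenvalues i : ℂ) q
  have hdet : T.det = 1 := det_transfer ha _ _
  have h1 : (T - Complex.I • 1).det = 0 := Matrix.exists_mulVec_eq_zero_iff.1
    ⟨v, hv, by rw [Matrix.sub_mulVec, Matrix.smul_mulVec, Matrix.one_mulVec, hTv, sub_self]⟩
  rw [Matrix.det_fin_two] at hdet h1
  simp at h1
  rw [Matrix.trace_fin_two]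
  have h2 : Complex.I * (T 0 0 + T 1 1) = 0 := by
    linear_combination hdet - h1 + Complex.I_sq
  simpa using h2

end XYChain

/-! ### Measure of the bands -/

namespace XYChain

open Matrix MeasureTheory

variable {a b a' b' : ℤ → ℝ}

/-- Uniform bounds on the coefficients of a Jacobi operator. -/
structure CoeffBounds (a b : ℤ → ℝ) (α β γ : ℝ) : Prop where
  pos : 0 < α
  le_hop : ∀ k, α ≤ a k
  hop_le : ∀ k, a k ≤ β
  field_le : ∀ k, |b k| ≤ γ

/-- A bound on one-step transfer matrices at bounded energies. -/
def stepBound (α β γ : ℝ) : ℝ := (2 * β + 2 * γ + 2) / α + β + 1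

/-- A Lipschitz constant for one-step transfer matrices at bounded energies. -/
def stepLipschitz (α β γ : ℝ) : ℝ := (2 * β + 2 * γ + 2) / α ^ 2 + 1 / α + 1

namespace CoeffBounds

variable {α β γ : ℝ} (h : CoeffBounds a b α β γ)
include h

theorem hop_pos (k : ℤ) : 0 < a k := h.pos.trans_le (h.le_hop k)

theorem abs_hop_le (k : ℤ) : |a k| ≤ β := by rw [abs_of_pos (h.hop_pos k)]; exact h.hop_le k

theorem beta_pos : 0 < β := (h.hop_pos 0).trans_le (h.hop_le 0)

theorem gamma_nonneg : 0 ≤ γ := (abs_nonneg _).trans (h.field_le 0)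

theorem one_le_stepBound : 1 ≤ stepBound α β γ := by
  have := h.pos; have := h.beta_pos; have := h.gamma_nonneg
  unfold stepBound
  have : 0 ≤ (2 * β + 2 * γ + 2) / α := by positivity
  linarith

theorem one_le_stepLipschitz : 1 ≤ stepLipschitz α β γ := by
  have := h.pos; have := h.beta_pos; have := h.gamma_nonneg
  unfold stepLipschitz
  have h1 : 0 ≤ (2 * β + 2 * γ + 2) / α ^ 2 := by positivity
  have h2 : 0 ≤ 1 / α := by positivity
  linarith

/-- The energy window exceeds the range `2 * β + γ` of the bands by one, to leave room for moving a
band energy by at most one. -/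
theorem norm_sub_field_le {x : ℝ} (hx : |x| ≤ 2 * β + γ + 1) (k : ℤ) :
    ‖(x : ℂ) - b k‖ ≤ 2 * β + 2 * γ + 1 := by
  rw [← Complex.ofReal_sub, Complex.norm_real, Real.norm_eq_abs]
  exact (abs_sub _ _).trans (by linarith [h.field_le k])

theorem norm_transferStep_le {x : ℝ} (hx : |x| ≤ 2 * β + γ + 1) (k : ℤ) :
    ‖transferStep a b x k‖ ≤ stepBound α β γ := by
  refine (XYChain.norm_transferStep_le h.pos (h.le_hop k) (h.hop_le k)
    (h.norm_sub_field_le hx k)).trans ?_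
  unfold stepBound
  rw [show 2 * β + 2 * γ + 1 + 1 = 2 * β + 2 * γ + 2 by ring]
  linarith

theorem abs_le_of_mem_bands {q : ℕ} (hq : 0 < q) (hpa : Function.Periodic a q)
    (hpb : Function.Periodic b q) {x : ℝ} (hx : x ∈ bands a b q) : |x| ≤ 2 * β + γ :=
  XYChain.abs_le_of_mem_bands hq h.hop_pos hpa hpb h.abs_hop_le h.field_le hx

omit h in
theorem norm_transferStep_sub_le (h : CoeffBounds a b α β γ) (h' : CoeffBounds a' b' α β γ)
    {x y δ : ℝ} (hx : |x| ≤ 2 * β + γ + 1) {k : ℤ} (ha : |a k - a' k| ≤ δ)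
    (hb : |(x - b k) - (y - b' k)| ≤ δ) :
    ‖transferStep a b x k - transferStep a' b' y k‖ ≤ stepLipschitz α β γ * δ := by
  refine (XYChain.norm_transferStep_sub_le h.pos (h.le_hop k) (h'.le_hop k)
    (h.norm_sub_field_le hx k) ha ?_).trans (le_of_eq ?_)
  · have : ((x : ℂ) - b k) - ((y : ℂ) - b' k) = (((x - b k) - (y - b' k) : ℝ) : ℂ) := by
      push_cast; ring
    rw [this, Complex.norm_real]; exact hb
  · unfold stepLipschitz
    rw [show 2 * β + 2 * γ + 1 + 1 = 2 * β + 2 * γ + 2 by ring]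

/-- The bands of a periodic Jacobi operator are at most exponentially thin in the period. -/
theorem le_volume_bands {q : ℕ} (hq : 0 < q) (hpa : Function.Periodic a q)
    (hpb : Function.Periodic b q) :
    ENNReal.ofReal (1 / (q * stepBound α β γ ^ q * stepLipschitz α β γ)) ≤
      volume (bands a b q) := by
  set κ := stepBound α β γ
  set D := stepLipschitz α β γ
  have hκ : 1 ≤ κ := h.one_le_stepBound
  have hD : 1 ≤ D := h.one_le_stepLipschitz
  have hq1 : (1 : ℝ) ≤ q := by exact_mod_cast hq
  have hden : 1 ≤ q * κ ^ q * D :=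
    one_le_mul_of_one_le_of_one_le (one_le_mul_of_one_le_of_one_le hq1 (one_le_pow₀ hκ)) hD
  set r := 1 / (q * κ ^ q * D) with hr
  have hr1 : r ≤ 1 := by rw [hr, div_le_one (by linarith)]; exact hden
  have hr0 : 0 < r := by positivity
  obtain ⟨x₀, hx₀⟩ := exists_trace_transfer_eq_zero hq h.hop_pos hpa hpb
  have hx₀' : |x₀| ≤ 2 * β + γ := h.abs_le_of_mem_bands hq hpa hpb
    (by rw [bands, Set.mem_ofPred_eq, hx₀]; simp)
  -- The trace vanishes at `x₀` and has Lipschitz constant `2 * q * κ ^ q * D` in the window, so it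
  -- is still at most 2 in modulus at distance `r`.
  have hsub : Set.Icc x₀ (x₀ + r) ⊆ bands a b q := by
    intro x hx
    have hd : |x - x₀| ≤ r := by rw [abs_le]; constructor <;> linarith [hx.1, hx.2]
    have hxR : |x| ≤ 2 * β + γ + 1 := by
      have := abs_add_le (x - x₀) x₀
      rw [sub_add_cancel] at this; linarith
    have h1 := XYChain.norm_transfer_sub_le (z := (x : ℂ)) (z' := (x₀ : ℂ)) hκ
      (h.norm_transferStep_le hxR) (h.norm_transferStep_le (by linarith))
      (fun k => h.norm_transferStep_sub_le h (δ := r) hxR (k := k)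
        (by simp [hr0.le]) (by convert hd using 2; ring)) q
    have h2 := norm_trace_fin_two_le (transfer a b x q - transfer a b x₀ q)
    rw [Matrix.trace_sub, hx₀, sub_zero] at h2
    refine h2.trans ?_
    have h3 : q * κ ^ q * (D * r) = 1 := by
      rw [hr]; field_simp
    linarith
  calc ENNReal.ofReal r = volume (Set.Icc x₀ (x₀ + r)) := by rw [Real.volume_Icc]; simp
    _ ≤ _ := measure_mono hsub

end CoeffBounds

/-- A lost point `x` has a point `y` of the other bands within `3 * δ`, and between them the modulus
of the trace passes through 2. So `x` is within `3 * δ` of a root of `p ^ 2 - 4`, which has at most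
`2 * q'` roots. -/
theorem volume_bands_diff_le {q q' : ℕ} (hq : 0 < q) (hq' : 0 < q') (ha : ∀ k, 0 < a k)
    (hpa : Function.Periodic a q) (hpb : Function.Periodic b q) (ha' : ∀ k, 0 < a' k)
    (hpa' : Function.Periodic a' q') (hpb' : Function.Periodic b' q') {δ : ℝ}
    (hδa : ∀ k, |a k - a' k| ≤ δ) (hδb : ∀ k, |b k - b' k| ≤ δ) :
    volume (bands a b q \ bands a' b' q') ≤ ENNReal.ofReal (12 * q' * δ) := by
  have hδ : 0 ≤ δ := (abs_nonneg _).trans (hδa 0)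
  obtain ⟨p, hpdeg, hp⟩ := exists_trace_poly a' b' q'
  have hmem : ∀ x, x ∈ bands a' b' q' ↔ |p.eval x| ≤ 2 := fun x => by
    rw [bands, Set.mem_ofPred_eq, hp, Complex.norm_real]; rfl
  set P := p ^ 2 - Polynomial.C 4 with hP
  have hcover : bands a b q \ bands a' b' q' ⊆
      ⋃ r ∈ P.roots.toFinset, Set.Icc (r - 3 * δ) (r + 3 * δ) := by
    rintro x ⟨hx, hx'⟩
    obtain ⟨y, hy, hxy⟩ := exists_mem_bands_near hq hq' ha hpa hpb ha' hpa' hpb' hδa hδb hx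
    rw [hmem] at hx' hy
    rw [not_le] at hx'
    have hcont : ContinuousOn (fun x => |p.eval x|) (Set.uIcc y x) := by fun_prop
    obtain ⟨r, hr, hr2⟩ := intermediate_value_uIcc hcont
      (show (2 : ℝ) ∈ Set.uIcc |p.eval y| |p.eval x| from Set.mem_uIcc.2 (Or.inl ⟨hy, hx'.le⟩))
    have hP0 : P ≠ 0 := by
      intro h0
      have h1 : P.eval x = 0 := by rw [h0, Polynomial.eval_zero]
      simp only [hP, Polynomial.eval_sub, Polynomial.eval_pow, Polynomial.eval_C] at h1
      nlinarith [sq_abs (p.eval x)]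
    have hroot : r ∈ P.roots.toFinset := by
      rw [Multiset.mem_toFinset, Polynomial.mem_roots hP0, Polynomial.IsRoot.def]
      simp only [hP, Polynomial.eval_sub, Polynomial.eval_pow, Polynomial.eval_C]
      rw [← sq_abs, show |p.eval r| = 2 from hr2]; norm_num
    have hxr : |x - r| ≤ 3 * δ := (Set.abs_sub_right_of_mem_uIcc hr).trans hxy
    rw [abs_le] at hxr
    simp only [Set.mem_iUnion]
    exact ⟨r, hroot, by linarith [hxr.1], by linarith [hxr.2]⟩
  have hcard : P.roots.toFinset.card ≤ 2 * q' := by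
    refine (Multiset.toFinset_card_le _).trans ((Polynomial.card_roots' _).trans ?_)
    refine (Polynomial.natDegree_sub_le _ _).trans (max_le ?_ (by simp))
    exact Polynomial.natDegree_pow_le.trans (Nat.mul_le_mul_left 2 hpdeg)
  calc _ ≤ volume (⋃ r ∈ P.roots.toFinset, Set.Icc (r - 3 * δ) (r + 3 * δ)) := measure_mono hcover
    _ ≤ ∑ r ∈ P.roots.toFinset, volume (Set.Icc (r - 3 * δ) (r + 3 * δ)) :=
        measure_biUnion_finset_le _ _
    _ = ∑ r ∈ P.roots.toFinset, ENNReal.ofReal (6 * δ) := by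
        refine Finset.sum_congr rfl fun r _ => ?_
        rw [Real.volume_Icc]; congr 1; ring
    _ = ENNReal.ofReal (P.roots.toFinset.card * (6 * δ)) := by
        rw [Finset.sum_const, nsmul_eq_mul,
          ENNReal.ofReal_mul (p := (P.roots.toFinset.card : ℝ)) (by positivity),
          ENNReal.ofReal_natCast]
    _ ≤ _ := by
        apply ENNReal.ofReal_le_ofReal
        have : (P.roots.toFinset.card : ℝ) ≤ 2 * q' := by exact_mod_cast hcard
        nlinarith

/-! ### Polynomials with real roots off the real axis -/

/-- The increase of `log |x - r|` when the real number `x` moves up by `ε` into the complex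
plane. -/
def logIncrement (ε y : ℝ) : ℝ := Real.log (1 + ε ^ 2 / y ^ 2) / 2

theorem lintegral_poisson {s : ℝ} (hs : 0 < s) :
    ∫⁻ y : ℝ, ENNReal.ofReal (s / (y ^ 2 + s ^ 2)) = ENNReal.ofReal Real.pi := by
  have e : (fun y : ℝ => s / (y ^ 2 + s ^ 2)) = fun y => s⁻¹ * (1 + (y / s) ^ 2)⁻¹ := by
    ext y; field_simp; ring
  have hint : Integrable (fun y : ℝ => s / (y ^ 2 + s ^ 2)) := by
    rw [e]
    exact ((integrable_inv_one_add_sq).comp_div hs.ne').const_mul _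
  rw [← ofReal_integral_eq_lintegral_ofReal hint (ae_of_all _ fun y => by positivity), e,
    integral_const_mul, Measure.integral_comp_div (fun u : ℝ => (1 + u ^ 2)⁻¹) s,
    integral_univ_inv_one_add_sq, abs_of_pos hs, smul_eq_mul, inv_mul_cancel_left₀ hs.ne']

/-- At `y = 0` the identity fails: division by zero makes `logIncrement ε 0 = 0`, while the integral
diverges. -/
theorem logIncrement_eq_lintegral {ε : ℝ} (hε : 0 < ε) {y : ℝ} (hy : y ≠ 0) :
    ENNReal.ofReal (logIncrement ε y) =
      ∫⁻ s in Set.Ioc 0 ε, ENNReal.ofReal (s / (y ^ 2 + s ^ 2)) := by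
  have hpos : ∀ s : ℝ, 0 < y ^ 2 + s ^ 2 := fun s => by positivity
  have hcont : Continuous fun s : ℝ => s / (y ^ 2 + s ^ 2) :=
    continuous_id.div (by fun_prop) fun s => (hpos s).ne'
  have hder : ∀ s ∈ Set.uIcc 0 ε,
      HasDerivAt (fun s : ℝ => Real.log (y ^ 2 + s ^ 2) / 2) (s / (y ^ 2 + s ^ 2)) s := by
    intro s _
    have h1 : HasDerivAt (fun s : ℝ => y ^ 2 + s ^ 2) (2 * s) s := by
      simpa using ((hasDerivAt_id s).pow 2).const_add (y ^ 2)
    exact ((h1.log (hpos s).ne').div_const 2).congr_deriv (by ring)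
  have hI := intervalIntegral.integral_eq_sub_of_hasDerivAt hder (hcont.intervalIntegrable _ _)
  rw [intervalIntegral.integral_of_le hε.le] at hI
  rw [← ofReal_integral_eq_lintegral_ofReal
    ((hcont.integrableOn_Icc (a := 0) (b := ε)).mono_set Set.Ioc_subset_Icc_self), hI]
  · congr 1
    have hy2 : 0 < y ^ 2 := by positivity
    rw [logIncrement, zero_pow two_ne_zero, add_zero, ← sub_div,
      ← Real.log_div (hpos ε).ne' hy2.ne']
    congr 2
    field_simp
  · refine (ae_restrict_iff' measurableSet_Ioc).2 (ae_of_all _ fun s hs => ?_)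
    exact div_nonneg hs.1.le (hpos s).le

theorem measurable_logIncrement (ε : ℝ) : Measurable (logIncrement ε) := by
  unfold logIncrement; fun_prop

/-- By Tonelli, this integrates over heights `s` in `(0, ε]` the Poisson kernel, whose total mass
`π` does not depend on `s`. -/
theorem lintegral_logIncrement {ε : ℝ} (hε : 0 < ε) :
    ∫⁻ y, ENNReal.ofReal (logIncrement ε y) = ENNReal.ofReal (Real.pi * ε) := by
  have h1 : ∫⁻ y, ENNReal.ofReal (logIncrement ε y) =
      ∫⁻ y : ℝ, ∫⁻ s in Set.Ioc 0 ε, ENNReal.ofReal (s / (y ^ 2 + s ^ 2)) := by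
    refine lintegral_congr_ae ?_
    have : ∀ᵐ y : ℝ, y ≠ 0 := by simp [ae_iff]
    filter_upwards [this] with y hy using logIncrement_eq_lintegral hε hy
  rw [h1, lintegral_lintegral_swap (by fun_prop)]
  have h2 : ∫⁻ s in Set.Ioc 0 ε, (∫⁻ y : ℝ, ENNReal.ofReal (s / (y ^ 2 + s ^ 2))) =
      ∫⁻ s in Set.Ioc 0 ε, ENNReal.ofReal Real.pi :=
    setLIntegral_congr_fun measurableSet_Ioc fun s hs => lintegral_poisson hs.1
  rw [h2, setLIntegral_const, Real.volume_Ioc, sub_zero,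
    ← ENNReal.ofReal_mul Real.pi_pos.le]

theorem lintegral_sum_logIncrement {ε : ℝ} (hε : 0 < ε) (s : Multiset ℂ) :
    Measurable (fun x => (s.map fun r => ENNReal.ofReal (logIncrement ε (x - r.re))).sum) ∧
    ∫⁻ x, (s.map fun r => ENNReal.ofReal (logIncrement ε (x - r.re))).sum =
      s.card * ENNReal.ofReal (Real.pi * ε) := by
  induction s using Multiset.induction with
  | empty => simp
  | cons r s ih =>
    obtain ⟨hm, hi⟩ := ih
    have hr : Measurable fun x => ENNReal.ofReal (logIncrement ε (x - r.re)) :=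
      ENNReal.measurable_ofReal.comp ((measurable_logIncrement ε).comp (measurable_id.sub_const _))
    simp only [Multiset.map_cons, Multiset.sum_cons, Multiset.card_cons]
    refine ⟨hr.add hm, ?_⟩
    rw [lintegral_add_left hr, hi, lintegral_sub_right_eq_self
      (fun x => ENNReal.ofReal (logIncrement ε x)), lintegral_logIncrement hε]
    push_cast; ring

theorem norm_prod_sub_eq {ε x : ℝ} (s : Multiset ℂ) (hs : ∀ r ∈ s, r.im = 0)
    (hx : (x : ℂ) ∉ s) :
    ‖(s.map fun r => (x + ε * Complex.I) - r).prod‖ =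
      ‖(s.map fun r => (x : ℂ) - r).prod‖ *
        Real.exp ((s.map fun r => logIncrement ε (x - r.re)).sum) := by
  induction s using Multiset.induction with
  | empty => simp
  | cons r s ih =>
    have hr := hs r (Multiset.mem_cons_self r s)
    have hxr : (x : ℂ) ≠ r := fun h => hx (h ▸ Multiset.mem_cons_self r s)
    simp only [Multiset.map_cons, Multiset.sum_cons, Multiset.prod_cons, norm_mul]
    rw [ih (fun r hr => hs r (Multiset.mem_cons_of_mem hr))
      (fun h => hx (Multiset.mem_cons_of_mem h)), Real.exp_add]
    have hrr : r = (r.re : ℂ) := Complex.ext rfl (by simp [hr])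
    have hne : x - r.re ≠ 0 := fun h => hxr (by rw [hrr, sub_eq_zero.1 h])
    have key : ‖(x + ε * Complex.I) - r‖ = ‖(x : ℂ) - r‖ *
        Real.exp (logIncrement ε (x - r.re)) := by
      have h1 : ‖(x + ε * Complex.I) - r‖ ^ 2 = (x - r.re) ^ 2 + ε ^ 2 := by
        rw [Complex.sq_norm, Complex.normSq_apply]; simp [hr]; ring
      have h2 : ‖(x : ℂ) - r‖ ^ 2 = (x - r.re) ^ 2 := by
        rw [Complex.sq_norm, Complex.normSq_apply]; simp [hr]; ring
      refine (pow_left_inj₀ (norm_nonneg _) (by positivity) two_ne_zero).1 ?_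
      rw [h1, mul_pow, h2, ← Real.exp_nat_mul, logIncrement]
      push_cast
      rw [mul_div_cancel₀ _ two_ne_zero, Real.exp_log (by positivity)]
      field_simp
    rw [key]; ring

theorem logIncrement_nonneg (ε y : ℝ) : 0 ≤ logIncrement ε y := by
  unfold logIncrement
  have : 0 ≤ ε ^ 2 / y ^ 2 := by positivity
  exact div_nonneg (Real.log_nonneg (by linarith)) two_pos.le

/-- A polynomial with real roots cannot be much larger on `S + iε` than on `S`. -/
theorem volume_mul_log_le {P : Polynomial ℂ} (hroots : ∀ r ∈ P.roots, r.im = 0)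
    {N : ℕ} (hN : P.natDegree ≤ N) {S : Set ℝ} {ε A B : ℝ} (hε : 0 < ε)
    (hA : 0 < A) (hB : 0 < B) (h1 : ∀ x ∈ S, A ≤ ‖P.eval (x + ε * Complex.I)‖)
    (h2 : ∀ x ∈ S, ‖P.eval (x : ℂ)‖ ≤ B) :
    ENNReal.ofReal (Real.log (A / B)) * volume S ≤ N * ENNReal.ofReal (Real.pi * ε) := by
  obtain ⟨hm, hi⟩ := lintegral_sum_logIncrement hε P.roots
  have hfac : ∀ z : ℂ, P.eval z = P.leadingCoeff * (P.roots.map fun r => z - r).prod := fun z => by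
    conv_lhs => rw [(IsAlgClosed.splits P).eq_prod_roots]
    rw [Polynomial.eval_mul, Polynomial.eval_C, Polynomial.eval_multiset_prod, Multiset.map_map]
    congr 2
    refine Multiset.map_congr rfl fun r _ => by simp
  -- The roots are removed because the factorization with `logIncrement` fails there; they form a
  -- null set.
  set Z : Set ℝ := (fun r : ℂ => r.re) '' (P.roots.toFinset : Set ℂ)
  have hZ : volume Z = 0 := ((P.roots.toFinset.finite_toSet).image _).measure_zero _
  have hpt : ∀ x ∈ S \ Z, ENNReal.ofReal (Real.log (A / B)) ≤
      (P.roots.map fun r => ENNReal.ofReal (logIncrement ε (x - r.re))).sum := by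
    rintro x ⟨hx, hxZ⟩
    have hxr : (x : ℂ) ∉ P.roots := fun h => hxZ ⟨x, by simpa using h, by simp⟩
    have e := norm_prod_sub_eq (ε := ε) P.roots hroots hxr
    have e1 := h1 x hx
    have e2 := h2 x hx
    rw [hfac, norm_mul] at e1 e2
    rw [e, ← mul_assoc] at e1
    have e3 : A ≤ B * Real.exp ((P.roots.map fun r => logIncrement ε (x - r.re)).sum) :=
      e1.trans (mul_le_mul_of_nonneg_right e2 (Real.exp_pos _).le)
    have e4 : Real.log (A / B) ≤ (P.roots.map fun r => logIncrement ε (x - r.re)).sum := by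
      rw [Real.log_le_iff_le_exp (by positivity), div_le_iff₀ hB]; linarith
    refine (ENNReal.ofReal_le_ofReal e4).trans (le_of_eq ?_)
    generalize P.roots = s
    induction s using Multiset.induction with
    | empty => simp
    | cons r s ih =>
      simp only [Multiset.map_cons, Multiset.sum_cons]
      rw [ENNReal.ofReal_add (logIncrement_nonneg _ _), ih]
      refine Multiset.sum_nonneg fun y hy => ?_
      obtain ⟨r, -, rfl⟩ := Multiset.mem_map.1 hy
      exact logIncrement_nonneg _ _
  calc ENNReal.ofReal (Real.log (A / B)) * volume S
      ≤ ENNReal.ofReal (Real.log (A / B)) * volume (S \ Z) := by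
        rw [measure_sdiff_null hZ]
    _ = ∫⁻ _ in S \ Z, ENNReal.ofReal (Real.log (A / B)) := by rw [setLIntegral_const]
    _ ≤ ∫⁻ x in S \ Z, (P.roots.map fun r => ENNReal.ofReal (logIncrement ε (x - r.re))).sum :=
        setLIntegral_mono hm hpt
    _ ≤ ∫⁻ x, (P.roots.map fun r => ENNReal.ofReal (logIncrement ε (x - r.re))).sum :=
        setLIntegral_le_lintegral _ _
    _ = P.roots.card * ENNReal.ofReal (Real.pi * ε) := hi
    _ ≤ _ := by
        gcongr
        exact_mod_cast (Polynomial.card_roots' P).trans hN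

end XYChain

/-! ### Resolvent and propagator -/

namespace XYChain

open Matrix

section Hermitian

variable {n : Type*} [Fintype n] [DecidableEq n] {A : Matrix n n ℂ}

theorem isHermitian_im_inner_mulVec (hA : A.IsHermitian) (v : EuclideanSpace ℂ n) :
    (inner ℂ v (WithLp.toLp 2 (A *ᵥ v.ofLp))).im = 0 :=
  (Matrix.isSymmetric_toEuclideanLin_iff.2 hA).im_inner_self_apply v

/-- The quadratic form of `A` is real, so `⟨v, (z - A) v⟩` has imaginary part `z.im * ‖v‖ ^ 2`; then
Cauchy–Schwarz. -/
theorem im_mul_norm_le_of_isHermitian (hA : A.IsHermitian) (z : ℂ) (v : EuclideanSpace ℂ n) :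
    |z.im| * ‖v‖ ≤ ‖WithLp.toLp 2 (z • v.ofLp - A *ᵥ v.ofLp)‖ := by
  rcases eq_or_ne v 0 with rfl | hv
  · simp
  have hpos : 0 < ‖v‖ := norm_pos_iff.2 hv
  have h1 : (inner ℂ v (WithLp.toLp 2 (z • v.ofLp - A *ᵥ v.ofLp))).im = z.im * ‖v‖ ^ 2 := by
    rw [WithLp.toLp_sub, inner_sub_right, Complex.sub_im, isHermitian_im_inner_mulVec hA, sub_zero,
      WithLp.toLp_smul, WithLp.toLp_ofLp, inner_smul_right, inner_self_eq_norm_sq_to_K]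
    change (z * (‖v‖ : ℂ) ^ 2).im = _
    rw [← Complex.ofReal_pow, Complex.mul_im, Complex.ofReal_im,
      Complex.ofReal_re]
    ring
  have h2 := (Complex.abs_im_le_norm _).trans
    (norm_inner_le_norm (𝕜 := ℂ) v (WithLp.toLp 2 (z • v.ofLp - A *ᵥ v.ofLp)))
  rw [h1, abs_mul, abs_of_nonneg (sq_nonneg ‖v‖)] at h2
  nlinarith

theorem norm_exp_neg_I_smul_le (hA : A.IsHermitian) (t : ℝ) :
    ‖NormedSpace.exp ((t : ℂ) • (-Complex.I • A))‖ ≤ 1 := by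
  set U := NormedSpace.exp ((t : ℂ) • (-Complex.I • A))
  have h := Matrix.l2_opNorm_conjTranspose_mul_self U
  have h1 : Uᴴ * U = 1 := by
    have h2 : ((t : ℂ) • (-Complex.I • A))ᴴ = -((t : ℂ) • (-Complex.I • A)) := by
      rw [Matrix.conjTranspose_smul, Matrix.conjTranspose_smul, hA.eq]
      simp
    rw [← Matrix.exp_conjTranspose, h2, ← Matrix.exp_add_of_commute _ _ ((Commute.refl ((t : ℂ) • (-Complex.I • A))).neg_left),
      neg_add_cancel, NormedSpace.exp_zero]
  have h2 : ‖(1 : Matrix n n ℂ)‖ ≤ 1 := by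
    rw [← Matrix.diagonal_one, Matrix.l2_opNorm_diagonal]
    exact (pi_norm_le_iff_of_nonneg zero_le_one).2 fun i => by simp
  rw [h1] at h
  nlinarith [norm_nonneg U]

/-- Bounds on the propagator up to time `T` bound the resolvent. -/
theorem norm_resolvent_le_of_propagator (hA : A.IsHermitian) {z : ℂ} (hz : 0 < z.im) {m i : n}
    {g : n → ℂ} (hg : z • g - A *ᵥ g = Pi.single m 1) {T B : ℝ} (hT : 0 ≤ T)
    (hU : ∀ t ∈ Set.Icc 0 T, ‖NormedSpace.exp ((t : ℂ) • (-Complex.I • A)) i m‖ ≤ B) :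
    ‖g i‖ ≤ Real.exp (-(z.im * T)) / z.im + B * T := by
  set Y := -Complex.I • A with hY
  -- The path `e^{itz} e^{-itA} g` starts at `g`, and since `(z - A) g = δ_m` its derivative is `i
  -- e^{itz} e^{-itA} δ_m`. This is the Laplace representation of the resolvent cut at time `T`: the
  -- derivative is controlled by `B`, and the endpoint by unitarity and the decay of `e^{itz}`.
  set V : ℂ → Matrix n n ℂ := fun u => Complex.exp (u * (Complex.I * z)) • NormedSpace.exp (u • Y)
    with hV
  set L : Matrix n n ℂ →ₗ[ℂ] ℂ :=
    { toFun := fun M => (M *ᵥ g) i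
      map_add' := fun M M' => by simp [Matrix.add_mulVec]
      map_smul' := fun c M => by simp [Matrix.smul_mulVec] } with hL
  have hLapp : ∀ M, L M = (M *ᵥ g) i := fun M => rfl
  have hVder : ∀ u : ℂ, HasDerivAt V (Complex.exp (u * (Complex.I * z)) •
      (NormedSpace.exp (u • Y) * Y) +
        (Complex.exp (u * (Complex.I * z)) * (Complex.I * z)) • NormedSpace.exp (u • Y)) u := by
    intro u
    have h1 : HasDerivAt (fun u : ℂ => Complex.exp (u * (Complex.I * z)))
        (Complex.exp (u * (Complex.I * z)) * (Complex.I * z)) u := by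
      simpa using ((hasDerivAt_id u).mul_const (Complex.I * z)).cexp
    exact h1.smul (hasDerivAt_exp_smul_const Y u)
  have hYg : Y *ᵥ g + (Complex.I * z) • g = Complex.I • Pi.single m (1 : ℂ) := by
    rw [← hg, hY, Matrix.smul_mulVec, smul_sub, smul_smul, neg_smul]; abel
  have hfder : ∀ t : ℝ, HasDerivAt (fun t : ℝ => L (V t))
      (Complex.I * Complex.exp (t * (Complex.I * z)) *
        NormedSpace.exp ((t : ℂ) • Y) i m) t := by
    intro t
    have h1 := (L.toContinuousLinearMap.hasFDerivAt.comp_hasDerivAt (t : ℂ) (hVder t)).comp_ofReal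
    refine HasDerivAt.congr_deriv h1 ?_
    change L _ = _
    rw [map_add, map_smul, map_smul, hLapp, hLapp, ← Matrix.mulVec_mulVec]
    have h2 : (NormedSpace.exp ((t : ℂ) • Y) *ᵥ (Y *ᵥ g + (Complex.I * z) • g)) i =
        Complex.I * NormedSpace.exp ((t : ℂ) • Y) i m := by
      rw [hYg, Matrix.mulVec_smul, Matrix.mulVec_single_one]; rfl
    rw [Matrix.mulVec_add, Matrix.mulVec_smul, Pi.add_apply, Pi.smul_apply] at h2
    simp only [smul_eq_mul] at h2 ⊢
    linear_combination Complex.exp (t * (Complex.I * z)) * h2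
  have hexp : ∀ t : ℝ, ‖Complex.exp (t * (Complex.I * z))‖ = Real.exp (-(z.im * t)) := by
    intro t
    rw [Complex.norm_exp]; congr 1; simp; ring
  have hmv := norm_image_sub_le_of_norm_deriv_le_segment' (f := fun t : ℝ => L (V t)) (C := B)
    (a := 0) (b := T) (fun t _ => (hfder t).hasDerivWithinAt) (by
      intro t ht
      have ht' : t ∈ Set.Icc 0 T := ⟨ht.1, ht.2.le⟩
      rw [norm_mul, norm_mul, Complex.norm_I, one_mul, hexp]
      have h1 : Real.exp (-(z.im * t)) ≤ 1 := Real.exp_le_one_iff.2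
        (by have := mul_nonneg hz.le ht.1; linarith)
      calc _ ≤ 1 * B := mul_le_mul h1 (hU t ht') (norm_nonneg _) zero_le_one
        _ = B := one_mul B) T ⟨hT, le_rfl⟩
  have h0 : L (V ((0 : ℝ) : ℂ)) = g i := by
    simp [hLapp, hV, NormedSpace.exp_zero]
  have hgn : ‖WithLp.toLp 2 g‖ ≤ 1 / z.im := by
    have h1 := im_mul_norm_le_of_isHermitian hA z (WithLp.toLp 2 g)
    rw [abs_of_pos hz] at h1
    change _ ≤ ‖WithLp.toLp 2 (z • g - A *ᵥ g)‖ at h1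
    have h2 : ‖WithLp.toLp 2 (Pi.single m (1 : ℂ) : n → ℂ)‖ = 1 := by
      have := PiLp.norm_single 2 (fun _ : n => ℂ) m (1 : ℂ)
      rw [norm_one] at this; exact this
    rw [hg, h2] at h1
    rw [le_div_iff₀ hz]; linarith
  have hfT : ‖L (V (T : ℂ))‖ ≤ Real.exp (-(z.im * T)) / z.im := by
    have h1 := Matrix.l2_opNorm_mulVec (V (T : ℂ)) (WithLp.toLp 2 g)
    have h2 := (PiLp.norm_apply_le (WithLp.toLp 2 (V (T : ℂ) *ᵥ g)) i).trans h1
    refine h2.trans ?_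
    have h3 : ‖V (T : ℂ)‖ ≤ Real.exp (-(z.im * T)) := by
      simp only [hV]
      rw [norm_smul, hexp]
      have := norm_exp_neg_I_smul_le hA T
      calc _ ≤ Real.exp (-(z.im * T)) * 1 :=
            mul_le_mul_of_nonneg_left this (Real.exp_pos _).le
        _ = _ := mul_one _
    calc _ ≤ Real.exp (-(z.im * T)) * (1 / z.im) :=
          mul_le_mul h3 hgn (norm_nonneg _) (Real.exp_pos _).le
      _ = _ := by ring
  rw [h0, sub_zero] at hmv
  calc ‖g i‖ = ‖L (V (T : ℂ)) - (L (V (T : ℂ)) - g i)‖ := by rw [sub_sub_cancel]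
    _ ≤ ‖L (V (T : ℂ))‖ + ‖L (V (T : ℂ)) - g i‖ := norm_sub_le _ _
    _ ≤ _ := add_le_add hfT hmv

end Hermitian

/-! ### Dirichlet Jacobi matrices and the transfer polynomial -/

/-- The Jacobi matrix with hopping `a` and field `b` on a finite set of sites. -/
def jacobiMatrix (a b : ℤ → ℝ) (Λ : Finset ℤ) : Matrix Λ Λ ℂ :=
  Matrix.of fun j k => (if (k : ℤ) = j + 1 then (a j : ℂ) else 0) +
    (if (k : ℤ) = j - 1 then (a k : ℂ) else 0) + (if (k : ℤ) = j then (b j : ℂ) else 0)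

variable {a b : ℤ → ℝ}

theorem isHermitian_jacobiMatrix (a b : ℤ → ℝ) (Λ : Finset ℤ) :
    (jacobiMatrix a b Λ).IsHermitian := by
  ext j k
  simp only [jacobiMatrix, Matrix.conjTranspose_apply, Matrix.of_apply, star_add]
  have e1 : ((j : ℤ) = k + 1) ↔ ((k : ℤ) = j - 1) := by omega
  have e2 : ((j : ℤ) = k - 1) ↔ ((k : ℤ) = j + 1) := by omega
  have e3 : ((j : ℤ) = k) ↔ ((k : ℤ) = j) := eq_comm
  simp only [e1, e2, e3]
  have e4 : (if (k : ℤ) = j then (b k : ℂ) else 0) = if (k : ℤ) = j then (b j : ℂ) else 0 := by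
    split_ifs with h
    · rw [h]
    · rfl
  rw [apply_ite star, apply_ite star, apply_ite star]
  simp only [star_zero, RCLike.star_def, Complex.conj_ofReal]
  rw [e4]; ring

theorem jacobiMatrix_mulVec (a b : ℤ → ℝ) (Λ : Finset ℤ) (F : ℤ → ℂ) (j : Λ) :
    (jacobiMatrix a b Λ *ᵥ fun k : Λ => F k) j =
      (if (j : ℤ) + 1 ∈ Λ then a j * F (j + 1) else 0) +
      (if (j : ℤ) - 1 ∈ Λ then a (j - 1) * F (j - 1) else 0) + b j * F j := by
  have h1 : (jacobiMatrix a b Λ *ᵥ fun k : Λ => F k) j = ∑ k ∈ Λ,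
      ((if k = (j : ℤ) + 1 then a j * F k else 0) + (if k = (j : ℤ) - 1 then a k * F k else 0) +
        (if k = (j : ℤ) then b j * F k else 0)) := by
    rw [← Finset.sum_coe_sort, Matrix.mulVec, dotProduct]
    refine Finset.sum_congr rfl fun k _ => ?_
    simp only [jacobiMatrix, Matrix.of_apply, add_mul, ite_mul, zero_mul]
  rw [h1, Finset.sum_add_distrib, Finset.sum_add_distrib, Finset.sum_ite_eq', Finset.sum_ite_eq',
    Finset.sum_ite_eq', if_pos j.2]

/-- The solution of the Jacobi equation with Dirichlet condition on the left. -/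
theorem jacobiMatrix_mulVec_transfer (ha : ∀ k, 0 < a k) (z : ℂ) (M : ℕ) :
    (z • (fun k : Finset.Icc (0 : ℤ) M => transfer a b z (k : ℤ).toNat 0 0) -
      jacobiMatrix a b (Finset.Icc (0 : ℤ) M) *ᵥ
        fun k : Finset.Icc (0 : ℤ) M => transfer a b z (k : ℤ).toNat 0 0) =
      Pi.single ⟨M, by simp⟩ (a M * transfer a b z (M + 1) 0 0) := by
  have hrec0 : a 0 * transfer a b z 1 0 0 = z - b 0 := by
    have hne : (a 0 : ℂ) ≠ 0 := by exact_mod_cast (ha 0).ne'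
    simp [transfer, transferStep]; field_simp
  have hrec : ∀ n : ℕ, a ((n + 1 : ℕ) : ℤ) * transfer a b z (n + 2) 0 0 =
      (z - b ((n + 1 : ℕ) : ℤ)) * transfer a b z (n + 1) 0 0 - a n * transfer a b z n 0 0 := by
    intro n
    have hne : (a ((n + 1 : ℕ) : ℤ) : ℂ) ≠ 0 := by exact_mod_cast (ha _).ne'
    have h1 : transfer a b z (n + 1) 1 0 = a n * transfer a b z n 0 0 := by
      simp [transfer_succ a b z n, transferStep, Matrix.mul_apply, Fin.sum_univ_two]
    rw [transfer_succ a b z (n + 1), Matrix.mul_apply, Fin.sum_univ_two, h1]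
    simp only [transferStep, Matrix.of_apply, Matrix.cons_val', Matrix.cons_val_zero,
      Matrix.cons_val_one, Matrix.cons_val_fin_one]
    field_simp
    ring
  ext j
  obtain ⟨j, hj⟩ := j
  obtain ⟨hj0, hjM⟩ := Finset.mem_Icc.1 hj
  obtain ⟨n, rfl⟩ := Int.eq_ofNat_of_zero_le hj0
  have hnM : n ≤ M := by exact_mod_cast hjM
  rw [Pi.sub_apply, jacobiMatrix_mulVec a b _ (fun k => transfer a b z k.toNat 0 0), Pi.smul_apply]
  have e1 : ((n : ℤ) + 1).toNat = n + 1 := by omega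
  simp only [Int.toNat_natCast, e1, smul_eq_mul, Finset.mem_Icc]
  rcases hnM.eq_or_lt with rfl | hlt
  · rw [Pi.single_eq_same, if_neg (by omega)]
    cases n with
    | zero => simp [transfer] at hrec0 ⊢; rw [hrec0]
    | succ p =>
      have e2 : (((p + 1 : ℕ) : ℤ) - 1) = p := by push_cast; ring
      rw [if_pos (by omega), e2, Int.toNat_natCast, hrec]; ring
  · rw [Pi.single_eq_of_ne (by simp [Subtype.ext_iff]; omega), if_pos (by omega)]
    cases n with
    | zero => simp [transfer] at hrec0 ⊢; rw [hrec0]; ring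
    | succ p =>
      have e2 : (((p + 1 : ℕ) : ℤ) - 1) = p := by push_cast; ring
      rw [if_pos (by omega), e2, Int.toNat_natCast, hrec]; ring

/-- At such `z` the Dirichlet solution also satisfies the condition on the right. It is an
eigenvector of a Hermitian matrix, nonzero because its value at the site `0` is 1. -/
theorem im_eq_zero_of_transfer_eq_zero (ha : ∀ k, 0 < a k) {z : ℂ} {M : ℕ}
    (hz : transfer a b z (M + 1) 0 0 = 0) : z.im = 0 := by
  have h1 := jacobiMatrix_mulVec_transfer (b := b) ha z M
  rw [hz, mul_zero, Pi.single_zero] at h1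
  have h2 := im_mul_norm_le_of_isHermitian (isHermitian_jacobiMatrix a b (Finset.Icc (0 : ℤ) M)) z
    (WithLp.toLp 2 fun k : Finset.Icc (0 : ℤ) M => transfer a b z (k : ℤ).toNat 0 0)
  rw [h1, WithLp.toLp_zero, norm_zero] at h2
  have h3 : 0 < ‖WithLp.toLp 2
      fun k : Finset.Icc (0 : ℤ) M => transfer a b z (k : ℤ).toNat 0 0‖ := by
    refine norm_pos_iff.2 fun h0 => ?_
    have h4 := congrFun (congrArg WithLp.ofLp h0) ⟨0, by simp⟩
    simp [transfer] at h4
  have h4 : |z.im| ≤ 0 := by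
    by_contra hcon
    push Not at hcon
    have := mul_pos hcon h3
    linarith
  exact abs_eq_zero.1 (le_antisymm h4 (abs_nonneg _))

/-- The Dirichlet solution divided by `a M * transfer a b z (M + 1) 0 0` is column `M` of the
resolvent, and its value at the site `0` is the reciprocal of this number. A small resolvent entry
thus means a large transfer entry. -/
theorem one_le_transfer_mul_of_propagator (ha : ∀ k, 0 < a k) {z : ℂ} (hz : 0 < z.im) {M : ℕ}
    {T B : ℝ} (hT : 0 ≤ T) (hU : ∀ t ∈ Set.Icc 0 T, ‖NormedSpace.exp ((t : ℂ) •
      (-Complex.I • jacobiMatrix a b (Finset.Icc (0 : ℤ) M))) ⟨0, by simp⟩ ⟨M, by simp⟩‖ ≤ B) :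
    1 ≤ a M * ‖transfer a b z (M + 1) 0 0‖ * (Real.exp (-(z.im * T)) / z.im + B * T) := by
  set c : ℂ := a M * transfer a b z (M + 1) 0 0 with hc
  have haM : (a M : ℂ) ≠ 0 := by exact_mod_cast (ha M).ne'
  have hc0 : c ≠ 0 := mul_ne_zero haM fun h0 => hz.ne' (im_eq_zero_of_transfer_eq_zero ha h0)
  have h1 := jacobiMatrix_mulVec_transfer (b := b) ha z M
  rw [← hc] at h1
  have h2 := norm_resolvent_le_of_propagator (isHermitian_jacobiMatrix a b (Finset.Icc (0 : ℤ) M))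
    hz (m := ⟨M, by simp⟩) (i := ⟨0, by simp⟩)
    (g := c⁻¹ • fun k : Finset.Icc (0 : ℤ) M => transfer a b z (k : ℤ).toNat 0 0)
    (by rw [Matrix.mulVec_smul, smul_comm, ← smul_sub, h1, ← Pi.single_smul, smul_eq_mul,
          inv_mul_cancel₀ hc0]) hT hU
  have h3 : ‖c‖ = a M * ‖transfer a b z (M + 1) 0 0‖ := by
    rw [hc, norm_mul, Complex.norm_real, Real.norm_of_nonneg (ha M).le]
  rw [← h3]
  have h4 : ‖c‖⁻¹ ≤ Real.exp (-(z.im * T)) / z.im + B * T := by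
    simpa [transfer] using h2
  calc (1 : ℝ) = ‖c‖ * ‖c‖⁻¹ := (mul_inv_cancel₀ (norm_ne_zero_iff.2 hc0)).symm
    _ ≤ _ := mul_le_mul_of_nonneg_left h4 (norm_nonneg _)

end XYChain

/-! ### The sector with one spin up -/

namespace XYChain

open Matrix

variable {Λ : Finset ℤ}

/-- The basis vector of a classical configuration. -/
abbrev ket (s : Config Λ) : Config Λ → ℂ := Pi.single s 1

theorem onSite_mulVec_ket (A : Matrix (Fin 2) (Fin 2) ℂ) (j : Λ) (s : Config Λ) :
    onSite A j *ᵥ ket s = A 0 (s j) • ket (Function.update s j 0) +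
      A 1 (s j) • ket (Function.update s j 1) := by
  ext t
  rw [Matrix.mulVec_single_one]
  have hiff : ∀ x, t = Function.update s j x ↔ (∀ k, k ≠ j → t k = s k) ∧ t j = x := by
    intro x
    rw [Function.eq_update_iff, and_comm]
  simp only [Matrix.col_apply, onSite, Matrix.of_apply, Pi.add_apply, Pi.smul_apply,
    Pi.single_apply, hiff, smul_eq_mul]
  by_cases h : ∀ k, k ≠ j → t k = s k
  · have h' : ∀ x, ((∀ k, k ≠ j → t k = s k) ∧ t j = x) ↔ t j = x := fun x => and_iff_right h
    simp only [if_pos h, h']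
    generalize t j = y
    fin_cases y <;> simp
  · have h' : ∀ x, ((∀ k, k ≠ j → t k = s k) ∧ t j = x) ↔ False := fun x =>
      iff_false_intro fun e => h e.1
    simp only [if_neg h, h', if_false, mul_zero, add_zero]

theorem onSite_mul_comm (A B : Matrix (Fin 2) (Fin 2) ℂ) {j k : Λ} (hjk : j ≠ k) :
    onSite A j * onSite B k = onSite B k * onSite A j := by
  refine Matrix.ext_of_mulVec_single fun s => ?_
  change _ *ᵥ ket s = _ *ᵥ ket s
  rw [← Matrix.mulVec_mulVec, ← Matrix.mulVec_mulVec]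
  simp only [onSite_mulVec_ket, Matrix.mulVec_add, Matrix.mulVec_smul, smul_add, smul_smul,
    Function.update_of_ne hjk, Function.update_of_ne hjk.symm, Function.update_comm hjk]
  simp only [mul_comm (A _ _)]
  abel

theorem onSite_transpose (A : Matrix (Fin 2) (Fin 2) ℂ) (j : Λ) :
    (onSite A j)ᵀ = onSite Aᵀ j := by
  ext s t
  simp only [onSite, Matrix.transpose_apply, Matrix.of_apply]
  congr 1
  exact propext (forall₂_congr fun _ _ => eq_comm)

theorem onSite_neg (A : Matrix (Fin 2) (Fin 2) ℂ) (j : Λ) : onSite (-A) j = -onSite A j := by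
  ext s t
  simp only [onSite, Matrix.neg_apply, Matrix.of_apply]
  split_ifs <;> simp

/-- `σʸ` is antisymmetric but enters in pairs. The symmetry turns the eigenvector equation for the
all-down column into one for the all-down row. -/
theorem transpose_hamiltonian (μ ν : ℤ → ℝ) (Λ : Finset ℤ) :
    (hamiltonian μ ν Λ)ᵀ = hamiltonian μ ν Λ := by
  have hX : pauliXᵀ = pauliX := by ext i j; fin_cases i <;> fin_cases j <;> rfl
  have hZ : pauliZᵀ = pauliZ := by ext i j; fin_cases i <;> fin_cases j <;> rfl
  have hY : pauliYᵀ = -pauliY := by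
    ext i j; fin_cases i <;> fin_cases j <;> simp [pauliY]
  unfold hamiltonian
  rw [Matrix.transpose_sub, Matrix.transpose_neg, Matrix.transpose_sum, Matrix.transpose_sum]
  simp only [Matrix.transpose_smul, onSite_transpose, hZ]
  congr 2
  refine Finset.sum_congr rfl fun j _ => ?_
  rw [Matrix.transpose_sum]
  refine Finset.sum_congr rfl fun k _ => ?_
  split_ifs with h
  · have hjk : k ≠ j := fun e => by rw [e] at h; omega
    rw [Matrix.transpose_smul, Matrix.transpose_add, Matrix.transpose_mul, Matrix.transpose_mul,
      onSite_transpose, onSite_transpose, onSite_transpose, onSite_transpose, hX, hY, onSite_neg,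
      onSite_neg, neg_mul_neg, onSite_mul_comm _ _ hjk, onSite_mul_comm _ _ hjk]
  · exact Matrix.transpose_zero

/-- The configuration with all spins down. -/
def vacuum (Λ : Finset ℤ) : Config Λ := fun _ => 1

/-- The configuration with a single spin up, at the site `j`. -/
def oneUp (j : Λ) : Config Λ := Function.update (vacuum Λ) j 0

/-- The energy of the configuration with all spins down. -/
def vacuumEnergy (ν : ℤ → ℝ) (Λ : Finset ℤ) : ℂ := ∑ j : Λ, (ν j : ℂ)

/-- Both terms flip both spins. Their amplitudes cancel when the spins agree; when they differ the
amplitudes add up to 2 and the spins are exchanged. -/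
theorem exchange_mulVec_of_eq {j k : Λ} (hjk : j ≠ k) {s : Config Λ} (h : s j = s k) :
    (onSite pauliX j * onSite pauliX k + onSite pauliY j * onSite pauliY k) *ᵥ ket s = 0 := by
  rw [Matrix.add_mulVec, ← Matrix.mulVec_mulVec, ← Matrix.mulVec_mulVec]
  simp only [onSite_mulVec_ket, Matrix.mulVec_add, Matrix.mulVec_smul,
    Function.update_of_ne hjk, h]
  generalize s k = y
  fin_cases y <;> simp [pauliX, pauliY] <;> simp [smul_smul]

theorem exchange_mulVec_of_ne {j k : Λ} (hjk : j ≠ k) {s : Config Λ} (h : s j ≠ s k) :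
    (onSite pauliX j * onSite pauliX k + onSite pauliY j * onSite pauliY k) *ᵥ ket s =
      (2 : ℂ) • ket (Function.update (Function.update s k (s j)) j (s k)) := by
  have h2 : ∀ x y : Fin 2, x ≠ y → (x = 0 ∧ y = 1) ∨ (x = 1 ∧ y = 0) := by decide
  rw [Matrix.add_mulVec, ← Matrix.mulVec_mulVec, ← Matrix.mulVec_mulVec]
  simp only [onSite_mulVec_ket, Matrix.mulVec_add, Matrix.mulVec_smul,
    Function.update_of_ne hjk]
  rcases h2 _ _ h with ⟨e1, e2⟩ | ⟨e1, e2⟩ <;> rw [e1, e2] <;> simp [pauliX, pauliY] <;>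
    rw [smul_smul, two_smul] <;> simp

theorem pauliZ_mulVec_ket (j : Λ) (s : Config Λ) :
    onSite pauliZ j *ᵥ ket s = (if s j = 0 then (1 : ℂ) else -1) • ket s := by
  have h2 : ∀ x : Fin 2, x = 0 ∨ x = 1 := by decide
  rw [onSite_mulVec_ket]
  rcases h2 (s j) with e | e
  · have : Function.update s j 0 = s := by rw [← e, Function.update_eq_self]
    rw [e, this]; simp [pauliZ]
  · have : Function.update s j 1 = s := by rw [← e, Function.update_eq_self]
    rw [e, this]; simp [pauliZ]

theorem hamiltonian_mulVec (μ ν : ℤ → ℝ) (s : Config Λ) :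
    hamiltonian μ ν Λ *ᵥ ket s =
      -(∑ j : Λ, ∑ k : Λ, if (k : ℤ) = (j : ℤ) + 1 then (μ j : ℂ) •
        ((onSite pauliX j * onSite pauliX k + onSite pauliY j * onSite pauliY k) *ᵥ ket s)
        else 0) - ∑ j : Λ, (ν j : ℂ) • (if s j = 0 then (1 : ℂ) else -1) • ket s := by
  unfold hamiltonian
  rw [Matrix.sub_mulVec, Matrix.neg_mulVec, Matrix.sum_mulVec, Matrix.sum_mulVec]
  refine congrArg₂ (· - ·) (congrArg Neg.neg (Finset.sum_congr rfl fun j _ => ?_))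
    (Finset.sum_congr rfl fun j _ => ?_)
  · rw [Matrix.sum_mulVec]
    refine Finset.sum_congr rfl fun k _ => ?_
    split_ifs
    · rw [Matrix.smul_mulVec]
    · rw [Matrix.zero_mulVec]
  · rw [Matrix.smul_mulVec, pauliZ_mulVec_ket]

theorem hamiltonian_mulVec_vacuum (μ ν : ℤ → ℝ) (Λ : Finset ℤ) :
    hamiltonian μ ν Λ *ᵥ ket (vacuum Λ) = vacuumEnergy ν Λ • ket (vacuum Λ) := by
  rw [hamiltonian_mulVec, Finset.sum_eq_zero, vacuumEnergy, Finset.sum_smul, neg_zero, zero_sub,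
    ← Finset.sum_neg_distrib]
  · refine Finset.sum_congr rfl fun j _ => ?_
    simp [vacuum]
  · intro j _
    refine Finset.sum_eq_zero fun k _ => ?_
    split_ifs with h
    · have hjk : j ≠ k := fun e => by rw [e] at h; omega
      rw [exchange_mulVec_of_eq hjk rfl, smul_zero]
    · rfl

theorem oneUp_self (j : Λ) : oneUp j j = 0 := Function.update_self _ _ _

theorem oneUp_of_ne {i j : Λ} (h : i ≠ j) : oneUp j i = 1 := Function.update_of_ne h _ _

theorem exchange_mulVec_oneUp {j k : Λ} (hjk : j ≠ k) (i : Λ) :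
    (onSite pauliX j * onSite pauliX k + onSite pauliY j * onSite pauliY k) *ᵥ ket (oneUp i) =
      (if i = j then (2 : ℂ) • ket (oneUp k) else 0) +
        (if i = k then (2 : ℂ) • ket (oneUp j) else 0) := by
  have hswap : ∀ j k : Λ, j ≠ k →
      Function.update (Function.update (oneUp j) k 0) j 1 = oneUp k := by
    intro j k hjk
    ext l : 1
    by_cases hlj : l = j
    · subst hlj; rw [Function.update_self, oneUp_of_ne hjk]
    · rw [Function.update_of_ne hlj]
      by_cases hlk : l = k
      · subst hlk; rw [Function.update_self, oneUp_self]
      · rw [Function.update_of_ne hlk, oneUp_of_ne hlj, oneUp_of_ne hlk]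
  by_cases hij : i = j
  · subst hij
    rw [if_pos rfl, if_neg hjk, add_zero, exchange_mulVec_of_ne hjk, oneUp_self,
      oneUp_of_ne hjk.symm, hswap _ _ hjk]
    rw [oneUp_self, oneUp_of_ne hjk.symm]; decide
  · by_cases hik : i = k
    · subst hik
      rw [if_neg hij, if_pos rfl, zero_add, exchange_mulVec_of_ne hjk, oneUp_self,
        oneUp_of_ne hjk, Function.update_comm hjk.symm, hswap _ _ hjk.symm]
      rw [oneUp_self, oneUp_of_ne hjk]; decide
    · rw [if_neg hij, if_neg hik, exchange_mulVec_of_eq hjk, add_zero]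
      rw [oneUp_of_ne (Ne.symm hij), oneUp_of_ne (Ne.symm hik)]

/-- The embedding of the one-particle space as the sector with a single spin up. -/
def oneUpEmbedding (Λ : Finset ℤ) : Matrix (Config Λ) Λ ℂ :=
  Matrix.of fun s j => if s = oneUp j then 1 else 0

theorem oneUpEmbedding_mulVec_single (i : Λ) :
    oneUpEmbedding Λ *ᵥ Pi.single i 1 = ket (oneUp i) := by
  ext s
  rw [Matrix.mulVec_single_one]
  simp [oneUpEmbedding, Pi.single_apply]

theorem oneUpEmbedding_mulVec (g : Λ → ℂ) :
    oneUpEmbedding Λ *ᵥ g = ∑ k, g k • ket (oneUp k) := by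
  ext s
  simp [oneUpEmbedding, Matrix.mulVec, dotProduct, Pi.single_apply]

/-- The exchange moves the single up spin to a neighbour with amplitude `2 μ`, and raising the spin
at `i` changes the field energy by `-2 ν i`. So the sector is invariant and the many-body dynamics
there is that of one particle. -/
theorem hamiltonian_mul_oneUpEmbedding (μ ν : ℤ → ℝ) (Λ : Finset ℤ) :
    hamiltonian μ ν Λ * oneUpEmbedding Λ =
      oneUpEmbedding Λ * (vacuumEnergy ν Λ • 1 - (2 : ℂ) • jacobiMatrix μ ν Λ) := by
  refine Matrix.ext_of_mulVec_single fun i => ?_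
  rw [← Matrix.mulVec_mulVec, ← Matrix.mulVec_mulVec, oneUpEmbedding_mulVec_single,
    hamiltonian_mulVec, Matrix.sub_mulVec, Matrix.smul_mulVec, Matrix.one_mulVec,
    Matrix.mulVec_sub, Matrix.mulVec_smul, oneUpEmbedding_mulVec_single, Matrix.smul_mulVec,
    Matrix.mulVec_smul, Matrix.mulVec_single_one, oneUpEmbedding_mulVec]
  have hfield : ∑ j : Λ, (ν j : ℂ) • (if oneUp i j = 0 then (1 : ℂ) else -1) • ket (oneUp i) =
      (2 * ν i - vacuumEnergy ν Λ) • ket (oneUp i) := by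
    have h1 : ∀ j : Λ, (ν j : ℂ) • (if oneUp i j = 0 then (1 : ℂ) else -1) • ket (oneUp i) =
        ((if j = i then 2 * (ν j : ℂ) else 0) - ν j) • ket (oneUp i) := by
      intro j
      rw [smul_smul]
      congr 1
      by_cases h : j = i
      · subst h; rw [oneUp_self, if_pos rfl, if_pos rfl]; ring
      · rw [oneUp_of_ne h, if_neg h, if_neg (by decide)]; ring
    rw [Finset.sum_congr rfl fun j _ => h1 j, ← Finset.sum_smul, Finset.sum_sub_distrib,
      Finset.sum_ite_eq', if_pos (Finset.mem_univ _), vacuumEnergy]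
  have hhop : (∑ j : Λ, ∑ k : Λ, if (k : ℤ) = (j : ℤ) + 1 then (μ j : ℂ) •
        ((onSite pauliX j * onSite pauliX k + onSite pauliY j * onSite pauliY k) *ᵥ
          ket (oneUp i)) else 0) =
      (∑ k : Λ, (if (k : ℤ) = i + 1 then (2 * μ i : ℂ) else 0) • ket (oneUp k)) +
        ∑ j : Λ, (if (i : ℤ) = j + 1 then (2 * μ j : ℂ) else 0) • ket (oneUp j) := by
    have h1 : ∀ j k : Λ, (if (k : ℤ) = (j : ℤ) + 1 then (μ j : ℂ) •
        ((onSite pauliX j * onSite pauliX k + onSite pauliY j * onSite pauliY k) *ᵥ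
          ket (oneUp i)) else 0) =
        (if i = j then (if (k : ℤ) = j + 1 then (2 * μ j : ℂ) else 0) • ket (oneUp k) else 0) +
        (if i = k then (if (k : ℤ) = j + 1 then (2 * μ j : ℂ) else 0) • ket (oneUp j) else 0) := by
      intro j k
      by_cases h : (k : ℤ) = (j : ℤ) + 1
      · have hjk : j ≠ k := fun e => by rw [e] at h; omega
        rw [if_pos h, if_pos h, exchange_mulVec_oneUp hjk]
        split_ifs <;> simp [smul_smul, mul_comm]
      · simp [h]
    rw [Finset.sum_congr rfl fun j _ => Finset.sum_congr rfl fun k _ => h1 j k]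
    simp only [Finset.sum_add_distrib]
    congr 1
    · rw [Finset.sum_comm]
      exact Finset.sum_congr rfl fun k _ => by
        rw [Finset.sum_ite_eq, if_pos (Finset.mem_univ _)]
    · exact Finset.sum_congr rfl fun k _ => by
        rw [Finset.sum_ite_eq, if_pos (Finset.mem_univ _)]
  have hjac : (2 : ℂ) • ∑ k, (jacobiMatrix μ ν Λ).col i k • ket (oneUp k) =
      (∑ k : Λ, (if (k : ℤ) = i + 1 then (2 * μ i : ℂ) else 0) • ket (oneUp k)) +
        (∑ j : Λ, (if (i : ℤ) = j + 1 then (2 * μ j : ℂ) else 0) • ket (oneUp j)) +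
        (2 * ν i : ℂ) • ket (oneUp i) := by
    have h1 : (2 * ν i : ℂ) • ket (oneUp i) =
        ∑ k : Λ, (if k = i then (2 * ν i : ℂ) else 0) • ket (oneUp k) := by
      simp only [ite_smul, zero_smul]
      rw [Finset.sum_ite_eq', if_pos (Finset.mem_univ _)]
    rw [h1, Finset.smul_sum, ← Finset.sum_add_distrib, ← Finset.sum_add_distrib]
    refine Finset.sum_congr rfl fun k _ => ?_
    rw [smul_smul, ← add_smul, ← add_smul]
    congr 1
    simp only [Matrix.col_apply, jacobiMatrix, Matrix.of_apply]
    have e1 : ((i : ℤ) = k - 1) ↔ ((k : ℤ) = i + 1) := by omega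
    have e2 : ((i : ℤ) = k) ↔ k = i := by rw [eq_comm, Subtype.ext_iff]
    simp only [e1, e2]
    have e3 : (if k = i then (ν k : ℂ) else 0) = if k = i then (ν i : ℂ) else 0 := by
      split_ifs with h
      · rw [h]
      · rfl
    rw [e3, mul_add, mul_add, mul_ite, mul_ite, mul_ite, mul_zero]
    ring
  rw [hfield, hhop, hjac]
  simp only [sub_smul]
  abel

theorem exp_mul_of_intertwine {m n : Type*} [Fintype m] [DecidableEq m] [Fintype n] [DecidableEq n]
    {X : Matrix m m ℂ} {Y : Matrix n n ℂ} {W : Matrix m n ℂ} (h : X * W = W * Y) :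
    NormedSpace.exp X * W = W * NormedSpace.exp Y := by
  have hpow : ∀ k : ℕ, X ^ k * W = W * Y ^ k := by
    intro k
    induction k with
    | zero => simp
    | succ k ih => rw [pow_succ', Matrix.mul_assoc, ih, ← Matrix.mul_assoc, h, Matrix.mul_assoc,
        ← pow_succ']
  have h1 := (NormedSpace.exp_series_hasSum_exp' (𝕂 := ℂ) X).map
    (AddMonoidHom.mk' (fun M : Matrix m m ℂ => M * W) fun M M' => Matrix.add_mul M M' W)
    (show Continuous fun M : Matrix m m ℂ => M * W by fun_prop)
  have h2 := (NormedSpace.exp_series_hasSum_exp' (𝕂 := ℂ) Y).map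
    (AddMonoidHom.mk' (fun M : Matrix n n ℂ => W * M) fun M M' => Matrix.mul_add W M M')
    (show Continuous fun M : Matrix n n ℂ => W * M by fun_prop)
  refine h1.unique ?_
  have e : (AddMonoidHom.mk' (fun M : Matrix m m ℂ => M * W)
      fun M M' => Matrix.add_mul M M' W) ∘ (fun k : ℕ => ((k.factorial : ℂ))⁻¹ • X ^ k) =
      (AddMonoidHom.mk' (fun M : Matrix n n ℂ => W * M)
      fun M M' => Matrix.mul_add W M M') ∘ (fun k : ℕ => ((k.factorial : ℂ))⁻¹ • Y ^ k) := by
    ext1 k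
    simp [hpow]
  rw [e]
  exact h2

theorem exp_mulVec_of_eigenvector {m : Type*} [Fintype m] [DecidableEq m] {X : Matrix m m ℂ}
    {v : m → ℂ} {c : ℂ} (h : X *ᵥ v = c • v) :
    NormedSpace.exp X *ᵥ v = Complex.exp c • v := by
  -- The eigenvector is regarded as a matrix with one column, so that the intertwining lemma
  -- applies.
  have h1 : X * Matrix.of (fun i (_ : Unit) => v i) =
      Matrix.of (fun i (_ : Unit) => v i) * Matrix.diagonal fun _ : Unit => c := by
    ext i j
    have := congrFun h i
    rw [Matrix.mul_diagonal, Matrix.of_apply, mul_comm]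
    exact this
  have h2 := exp_mul_of_intertwine h1
  ext i
  have h3 := congrFun (congrFun h2 i) ()
  rw [Matrix.exp_diagonal, Matrix.mul_diagonal, Pi.coe_exp, ← Complex.exp_eq_exp_ℂ] at h3
  rw [Pi.smul_apply, smul_eq_mul, mul_comm]
  exact h3

end XYChain

/-! ### From the commutator to the one-particle propagator -/

namespace XYChain

open Matrix

variable {Λ : Finset ℤ}

theorem ket_apply_self (s : Config Λ) : ket s s = 1 := Pi.single_eq_same _ _

theorem ket_apply_of_ne {s t : Config Λ} (h : t ≠ s) : ket s t = 0 := Pi.single_eq_of_ne h _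

theorem onSite_mul (A B : Matrix (Fin 2) (Fin 2) ℂ) (j : Λ) :
    onSite A j * onSite B j = onSite (A * B) j := by
  refine Matrix.ext_of_mulVec_single fun s => ?_
  change _ *ᵥ ket s = _ *ᵥ ket s
  rw [← Matrix.mulVec_mulVec]
  simp only [onSite_mulVec_ket, Matrix.mulVec_add, Matrix.mulVec_smul, Function.update_self,
    Function.update_idem, Matrix.mul_apply, Fin.sum_univ_two, smul_add, add_smul, smul_smul,
    mul_comm (A _ _)]
  abel

theorem onSite_one (j : Λ) : onSite (1 : Matrix (Fin 2) (Fin 2) ℂ) j = 1 := by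
  have h2 : ∀ x : Fin 2, x = 0 ∨ x = 1 := by decide
  refine Matrix.ext_of_mulVec_single fun s => ?_
  change _ *ᵥ ket s = _ *ᵥ ket s
  rw [onSite_mulVec_ket, Matrix.one_mulVec]
  rcases h2 (s j) with e | e
  · have : Function.update s j 0 = s := by rw [← e, Function.update_eq_self]
    rw [e, this]; simp
  · have : Function.update s j 1 = s := by rw [← e, Function.update_eq_self]
    rw [e, this]; simp

theorem onSite_conjTranspose (A : Matrix (Fin 2) (Fin 2) ℂ) (j : Λ) :
    (onSite A j)ᴴ = onSite Aᴴ j := by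
  ext s t
  simp only [onSite, Matrix.conjTranspose_apply, Matrix.of_apply]
  rw [apply_ite star, star_zero]
  congr 1
  exact propext (forall₂_congr fun _ _ => eq_comm)

theorem norm_onSite_le_one {A : Matrix (Fin 2) (Fin 2) ℂ} (hA : Aᴴ * A = 1) (j : Λ) :
    ‖onSite A j‖ ≤ 1 := by
  have h := Matrix.l2_opNorm_conjTranspose_mul_self (onSite A j)
  rw [onSite_conjTranspose, onSite_mul, hA, onSite_one] at h
  have h2 : ‖(1 : Op Λ)‖ ≤ 1 := by
    rw [← Matrix.diagonal_one, Matrix.l2_opNorm_diagonal]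
    exact (pi_norm_le_iff_of_nonneg zero_le_one).2 fun i => by simp
  rw [h] at h2
  nlinarith [norm_nonneg (onSite A j)]

theorem pauliX_isometry : pauliXᴴ * pauliX = 1 := by
  ext i j; fin_cases i <;> fin_cases j <;> simp [pauliX, Matrix.mul_apply, Fin.sum_univ_two]

theorem pauliY_isometry : pauliYᴴ * pauliY = 1 := by
  ext i j; fin_cases i <;> fin_cases j <;> simp [pauliY, Matrix.mul_apply, Fin.sum_univ_two]

/-- The operator raising the spin at the site `j`. -/
def raising (j : Λ) : Op Λ :=
  (1 / 2 : ℂ) • (onSite pauliX j + Complex.I • onSite pauliY j)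

theorem norm_raising_le_one (j : Λ) : ‖raising j‖ ≤ 1 := by
  unfold raising
  rw [norm_smul]
  have h1 := norm_add_le (onSite pauliX j) (Complex.I • onSite pauliY j)
  rw [norm_smul, Complex.norm_I, one_mul] at h1
  have h2 := norm_onSite_le_one pauliX_isometry j
  have h3 := norm_onSite_le_one pauliY_isometry j
  have h4 : ‖(1 / 2 : ℂ)‖ = 1 / 2 := by simp
  rw [h4]; linarith

theorem raising_mulVec_vacuum (j : Λ) : raising j *ᵥ ket (vacuum Λ) = ket (oneUp j) := by
  unfold raising
  rw [Matrix.smul_mulVec, Matrix.add_mulVec, Matrix.smul_mulVec, onSite_mulVec_ket,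
    onSite_mulVec_ket]
  have e : vacuum Λ j = 1 := rfl
  simp only [e, pauliX, pauliY]
  ext s
  simp [oneUp]
  ring_nf
  simp
  ring

theorem raising_vacuum_apply (j : Λ) (s : Config Λ) : raising j (vacuum Λ) s = 0 := by
  have h2 : ∀ x : Fin 2, x = 0 ∨ x = 1 := by decide
  simp only [raising, Matrix.smul_apply, Matrix.add_apply, onSite, Matrix.of_apply]
  split_ifs
  · have e : vacuum Λ j = 1 := rfl
    rw [e]
    rcases h2 (s j) with e | e <;> simp [e, pauliX, pauliY]
  · simp

theorem raising_mem_observables {S : Finset ℤ} (j : Λ) (hj : (j : ℤ) ∈ S) :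
    raising j ∈ observables Λ S := by
  refine Subalgebra.smul_mem _ (add_mem ?_ (Subalgebra.smul_mem _ ?_ _)) _
  · exact Algebra.subset_adjoin ⟨j, _, hj, rfl⟩
  · exact Algebra.subset_adjoin ⟨j, _, hj, rfl⟩

theorem onSite_pauliX_vacuum_oneUp (j i : Λ) :
    onSite pauliX j (vacuum Λ) (oneUp i) = if i = j then 1 else 0 := by
  by_cases h : i = j
  · subst h
    have : ∀ k, k ≠ i → vacuum Λ k = oneUp i k := fun k hk => (oneUp_of_ne hk).symm
    rw [if_pos rfl, onSite, Matrix.of_apply, if_pos this, oneUp_self]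
    rfl
  · have : ¬ ∀ k, k ≠ j → vacuum Λ k = oneUp i k := fun hk => by
      have := hk i h
      rw [oneUp_self] at this
      exact absurd this (show ¬ (1 : Fin 2) = 0 by decide)
    rw [if_neg h, onSite, Matrix.of_apply, if_neg this]

theorem norm_exp_smul_one_add {m : Type*} [Fintype m] [DecidableEq m] (c : ℂ) (X : Matrix m m ℂ)
    (i j : m) : ‖NormedSpace.exp (c • (1 : Matrix m m ℂ) + X) i j‖ =
      ‖Complex.exp c‖ * ‖NormedSpace.exp X i j‖ := by
  have hc : Commute (c • (1 : Matrix m m ℂ)) X := (Commute.one_left X).smul_left c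
  rw [Matrix.exp_add_of_commute _ _ hc, Matrix.smul_one_eq_diagonal, Matrix.exp_diagonal,
    Matrix.diagonal_mul, Pi.coe_exp, ← Complex.exp_eq_exp_ℂ, norm_mul]

/-- A matrix element of the commutator of the evolved `σˣ` with a raising operator is a matrix
element of the one-particle propagator. -/
theorem norm_propagator_le_norm_commutator (μ ν : ℤ → ℝ) (t : ℝ) (i j : Λ) :
    ‖NormedSpace.exp (-((Complex.I * (t : ℂ)) •
        (vacuumEnergy ν Λ • 1 - (2 : ℂ) • jacobiMatrix μ ν Λ))) i j‖ ≤
      ‖⁅heisenberg μ ν Λ t (onSite pauliX i), raising j⁆‖ := by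
  set H := hamiltonian μ ν Λ
  set U := NormedSpace.exp (-((Complex.I * (t : ℂ)) •
        (vacuumEnergy ν Λ • 1 - (2 : ℂ) • jacobiMatrix μ ν Λ)))
  refine le_trans (le_of_eq ?_) (norm_entry_le_l2 _ (vacuum Λ) (vacuum Λ))
  -- The all-down row of a raising operator vanishes, so only one of the two orders in the
  -- commutator contributes to the vacuum expectation.
  have h1 : (raising j * heisenberg μ ν Λ t (onSite pauliX i)) (vacuum Λ) (vacuum Λ) = 0 := by
    rw [Matrix.mul_apply]
    exact Finset.sum_eq_zero fun s _ => by rw [raising_vacuum_apply, zero_mul]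
  have hint : NormedSpace.exp (-((Complex.I * (t : ℂ)) • H)) * oneUpEmbedding Λ =
      oneUpEmbedding Λ * U := by
    refine exp_mul_of_intertwine ?_
    rw [Matrix.neg_mul, Matrix.smul_mul, hamiltonian_mul_oneUpEmbedding, Matrix.mul_neg,
      Matrix.mul_smul]
  have hvac : ∀ s, NormedSpace.exp ((Complex.I * (t : ℂ)) • H) (vacuum Λ) s =
      Complex.exp (Complex.I * t * vacuumEnergy ν Λ) * ket (vacuum Λ) s := by
    intro s
    have hT : (NormedSpace.exp ((Complex.I * (t : ℂ)) • H))ᵀ =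
        NormedSpace.exp ((Complex.I * (t : ℂ)) • H) := by
      rw [← Matrix.exp_transpose, Matrix.transpose_smul, transpose_hamiltonian]
    have h2 : NormedSpace.exp ((Complex.I * (t : ℂ)) • H) *ᵥ ket (vacuum Λ) =
        Complex.exp (Complex.I * t * vacuumEnergy ν Λ) • ket (vacuum Λ) := by
      refine exp_mulVec_of_eigenvector ?_
      rw [Matrix.smul_mulVec, hamiltonian_mulVec_vacuum, smul_smul]
    have h3 := congrFun h2 s
    rw [Matrix.mulVec_single_one] at h3
    rw [← hT]
    exact h3
  -- The raising operator creates a particle at `j`, which propagates; `σˣ` at `i` can return to the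
  -- vacuum only from a particle at `i`; the vacuum evolves by a phase.
  have h2 : (heisenberg μ ν Λ t (onSite pauliX i) * raising j) (vacuum Λ) (vacuum Λ) =
      Complex.exp (Complex.I * t * vacuumEnergy ν Λ) * U i j := by
    have e1 : (heisenberg μ ν Λ t (onSite pauliX i) * raising j) (vacuum Λ) (vacuum Λ) =
        ((heisenberg μ ν Λ t (onSite pauliX i) * raising j) *ᵥ ket (vacuum Λ)) (vacuum Λ) := by
      rw [Matrix.mulVec_single_one]; rfl
    have e2 : NormedSpace.exp (-((Complex.I * (t : ℂ)) • H)) *ᵥ ket (oneUp j) =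
        ∑ k, U k j • ket (oneUp k) := by
      rw [← oneUpEmbedding_mulVec_single, Matrix.mulVec_mulVec, hint, ← Matrix.mulVec_mulVec,
        Matrix.mulVec_single_one, oneUpEmbedding_mulVec]
      rfl
    rw [e1, ← Matrix.mulVec_mulVec, raising_mulVec_vacuum, heisenberg, ← Matrix.mulVec_mulVec,
      e2, ← Matrix.mulVec_mulVec, Matrix.mulVec, dotProduct]
    refine (Finset.sum_congr rfl fun s _ => congrArg (· * _) (hvac s)).trans ?_
    rw [Finset.sum_eq_single (vacuum Λ)]
    · rw [ket_apply_self, mul_one]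
      congr 1
      rw [Matrix.mulVec_sum, Finset.sum_apply, Finset.sum_eq_single i]
      · rw [Matrix.mulVec_smul, Matrix.mulVec_single_one, Pi.smul_apply, Matrix.col_apply,
          onSite_pauliX_vacuum_oneUp, if_pos rfl, smul_eq_mul, mul_one]
      · intro k _ hk
        rw [Matrix.mulVec_smul, Matrix.mulVec_single_one, Pi.smul_apply, Matrix.col_apply,
          onSite_pauliX_vacuum_oneUp, if_neg hk, smul_zero]
      · simp
    · intro s _ hs
      rw [ket_apply_of_ne hs, mul_zero, zero_mul]
    · simp
  have hphase : ‖Complex.exp (Complex.I * t * vacuumEnergy ν Λ)‖ = 1 := by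
    have : Complex.I * t * vacuumEnergy ν Λ = ((t * ∑ j : Λ, ν j : ℝ) : ℂ) * Complex.I := by
      rw [vacuumEnergy]; push_cast; ring
    rw [this, Complex.norm_exp_ofReal_mul_I]
  rw [Ring.lie_def, Matrix.sub_apply, h1, h2, sub_zero, norm_mul, hphase, one_mul]

theorem separation_singleton (m n : ℤ) : separation {m} {n} = (m - n).natAbs := by
  unfold separation
  have : {d : ℕ | ∃ n₁ ∈ ({m} : Finset ℤ), ∃ n₂ ∈ ({n} : Finset ℤ), d = (n₁ - n₂).natAbs} =
      {(m - n).natAbs} := by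
    ext d; simp
  rw [this, csInf_singleton]

/-- The sector Hamiltonian is a constant minus `2 J`, so one-particle time `s` is chain time `-(s /
2)`, and the one-particle velocity is `v / 2`. -/
theorem LiebRobinsonBound.norm_propagator_le {μ ν : ℤ → ℝ} {C : Finset ℤ → Finset ℤ → ℝ}
    {c v : ℝ} (h : LiebRobinsonBound μ ν C c v) {M : ℕ} (hM : 0 < M) (s : ℝ) :
    ‖NormedSpace.exp ((s : ℂ) • (-Complex.I • jacobiMatrix μ ν (Finset.Icc (0 : ℤ) M)))
        ⟨0, by simp⟩ ⟨M, by simp⟩‖ ≤ C {0} {0} * Real.exp (-c * (M - v * (|s| / 2))) := by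
  set Λ := Finset.Icc (0 : ℤ) M with hΛ
  set i : Λ := ⟨0, by simp [hΛ]⟩
  set j : Λ := ⟨M, by simp [hΛ]⟩
  -- Translation invariance is what excludes a prefactor growing with `M`.
  have hC : C {0} {(M : ℤ)} = C {0} {0} := by
    have := h.prefactor_translate {0} {0} 0 M
    simpa [translate] using this
  have hb := h.bound 0 M {0} {(M : ℤ)} (by simp) (by simp) (by simp) (by simp)
    (by simp; omega) (onSite pauliX i)
    (Algebra.subset_adjoin ⟨i, _, by simp [i], rfl⟩) (raising j)
    (raising_mem_observables j (by simp [j])) (-(s / 2))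
  rw [separation_singleton, hC] at hb
  have hp := (norm_propagator_le_norm_commutator μ ν (-(s / 2)) i j).trans hb
  have e1 : -((Complex.I * ((-(s / 2) : ℝ) : ℂ)) •
      (vacuumEnergy ν Λ • (1 : Matrix Λ Λ ℂ) - (2 : ℂ) • jacobiMatrix μ ν Λ)) =
      (((s / 2 * ∑ j : Λ, ν j : ℝ) : ℂ) * Complex.I) • 1 +
        (s : ℂ) • (-Complex.I • jacobiMatrix μ ν Λ) := by
    rw [smul_sub, smul_smul, smul_smul, smul_smul, neg_sub, sub_eq_add_neg, ← neg_smul, add_comm]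
    congr 2
    · rw [vacuumEnergy]; push_cast; ring
    · push_cast; ring
  rw [e1, norm_exp_smul_one_add, Complex.norm_exp_ofReal_mul_I, one_mul] at hp
  refine hp.trans ?_
  have e2 : (((0 : ℤ) - (M : ℤ)).natAbs : ℝ) = M := by simp
  have e3 : |-(s / 2)| = |s| / 2 := by rw [abs_neg, abs_div, abs_two]
  rw [e2, e3]
  have hC0 : 0 < C {0} {0} := h.prefactor_pos _ _
  refine mul_le_mul_of_nonneg_right ?_ (Real.exp_pos _).le
  have h1 := norm_onSite_le_one pauliX_isometry i
  have h2 := norm_raising_le_one j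
  calc C {0} {0} * ‖onSite pauliX i‖ * ‖raising j‖ ≤ C {0} {0} * 1 * 1 := by gcongr
    _ = _ := by ring

end XYChain

/-! ### Persistence of the bands and the velocity bound -/

namespace XYChain

open MeasureTheory

variable {a b : ℤ → ℝ} {α β γ : ℝ}

/-- The coefficients `a'` and `b'` have period `q ≤ L` and approximate `a` and `b` up to `r`. -/
structure PeriodicApproximant (a b : ℤ → ℝ) (α β γ r : ℝ) (L : ℕ) (a' b' : ℤ → ℝ) (q : ℕ) :
    Prop where
  bounds : CoeffBounds a' b' α β γ
  period_pos : 0 < q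
  period_le : q ≤ L
  periodic_hop : Function.Periodic a' q
  periodic_field : Function.Periodic b' q
  hop_near : ∀ k, |a k - a' k| ≤ r
  field_near : ∀ k, |b k - b' k| ≤ r

/-- Two approximants of the same operator differ by at most `2 * r`, so `volume_bands_diff_le`
bounds the loss by `12 * L' * (2 * r)`. -/
theorem volume_bands_le_add {r r' : ℝ} (hr : r' ≤ r) {L L' q q' : ℕ} {a₁ b₁ a₂ b₂ : ℤ → ℝ}
    (h₁ : PeriodicApproximant a b α β γ r L a₁ b₁ q)
    (h₂ : PeriodicApproximant a b α β γ r' L' a₂ b₂ q') :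
    volume (bands a₁ b₁ q) ≤ volume (bands a₂ b₂ q') + ENNReal.ofReal (24 * L' * r) := by
  have htri : ∀ x y z : ℝ, |x - y| ≤ r → |x - z| ≤ r' → |y - z| ≤ 2 * r := by
    intro x y z h1 h2
    have := abs_sub_le y x z
    rw [abs_sub_comm y x] at this
    linarith
  have h := volume_bands_diff_le (δ := 2 * r) h₁.period_pos h₂.period_pos h₁.bounds.hop_pos
    h₁.periodic_hop h₁.periodic_field h₂.bounds.hop_pos h₂.periodic_hop h₂.periodic_field
    (fun k => htri _ _ _ (h₁.hop_near k) (h₂.hop_near k))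
    (fun k => htri _ _ _ (h₁.field_near k) (h₂.field_near k))
  have hr0 : 0 ≤ r := (abs_nonneg _).trans (h₁.hop_near 0)
  calc volume (bands a₁ b₁ q) ≤ volume (bands a₂ b₂ q' ∪ (bands a₁ b₁ q \ bands a₂ b₂ q')) :=
        measure_mono (by rw [Set.union_sdiff_self]; exact Set.subset_union_right)
    _ ≤ volume (bands a₂ b₂ q') + volume (bands a₁ b₁ q \ bands a₂ b₂ q') := measure_union_le _ _
    _ ≤ _ := by
        gcongr
        refine h.trans (ENNReal.ofReal_le_ofReal ?_)
        have : (q' : ℝ) ≤ L' := by exact_mod_cast h₂.period_le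
        nlinarith

/-- If a Jacobi operator is approximated fast enough by periodic ones, then the spectra of these
do not become thin. -/
theorem exists_le_volume_bands {η : ℝ} (hη : 4 * Real.log (stepBound α β γ) + 3 ≤ η)
    (happ : ∀ᶠ L : ℕ in atTop, ∃ a' b' q,
      PeriodicApproximant a b α β γ (Real.exp (-(η * L))) L a' b' q) :
    ∃ s : ℝ, 0 < s ∧ ∀ᶠ L : ℕ in atTop, ∃ a' b' q,
      PeriodicApproximant a b α β γ (Real.exp (-(η * L))) L a' b' q ∧
        ENNReal.ofReal s ≤ volume (bands a' b' q) := by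
  set l := Real.log (stepBound α β γ) with hl
  set D := stepLipschitz α β γ with hD
  have hlim : Tendsto (fun L : ℕ => 96 * D * ((L : ℝ) ^ 1 * Real.exp (-(L : ℝ)))) atTop (𝓝 0) := by
    have := ((Real.tendsto_pow_mul_exp_neg_atTop_nhds_zero 1).comp
      tendsto_natCast_atTop_atTop).const_mul (96 * D)
    simpa using this
  obtain ⟨L₀, hL₀⟩ := eventually_atTop.1 (happ.and ((hlim.eventually (ge_mem_nhds one_pos)).and
    (eventually_ge_atTop 1)))
  choose! a' b' q hq using fun L hL => (hL₀ L hL).1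
  obtain ⟨-, hsmall, hL₀1⟩ := hL₀ L₀ le_rfl
  have hL₀pos : (1 : ℝ) ≤ L₀ := by exact_mod_cast hL₀1
  have hb := (hq L₀ le_rfl).bounds
  have hκ1 : 1 ≤ stepBound α β γ := hb.one_le_stepBound
  have hl0 : 0 ≤ l := Real.log_nonneg hκ1
  have hκ : stepBound α β γ = Real.exp l := (Real.exp_log (by linarith)).symm
  have hD1 : 1 ≤ D := hb.one_le_stepLipschitz
  -- `V` bounds the measure of the bands at the starting scale from below. The later losses sum to
  -- order `exp (-(l + 2) * L₀)`, which is below `V / 2` because `96 * D * L₀ * exp (-L₀) ≤ 1`.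
  set V := Real.exp (-(l * L₀)) / (L₀ * D) with hV
  have hV0 : 0 < V := by positivity
  have hstart : ENNReal.ofReal V ≤ volume (bands (a' L₀) (b' L₀) (q L₀)) := by
    refine le_trans (ENNReal.ofReal_le_ofReal ?_) ((hq L₀ le_rfl).bounds.le_volume_bands
      (hq L₀ le_rfl).period_pos (hq L₀ le_rfl).periodic_hop (hq L₀ le_rfl).periodic_field)
    have hqL : (q L₀ : ℝ) ≤ L₀ := by exact_mod_cast (hq L₀ le_rfl).period_le
    have hq0 : (0 : ℝ) < q L₀ := by exact_mod_cast (hq L₀ le_rfl).period_pos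
    rw [hV, hκ, ← Real.exp_nat_mul, Real.exp_neg, ← one_div, div_div]
    refine one_div_le_one_div_of_le (by positivity) ?_
    have h1 : Real.exp (q L₀ * l) ≤ Real.exp (l * L₀) := Real.exp_le_exp.2 (by nlinarith)
    calc (q L₀ : ℝ) * Real.exp (q L₀ * l) * D ≤ L₀ * Real.exp (l * L₀) * D := by gcongr
      _ = _ := by ring
  -- The loss is bounded by a difference of consecutive exponentials, so that the sum over scales
  -- telescopes.
  have hstep : ∀ L, L₀ ≤ L → 24 * ((L + 1 : ℕ) : ℝ) * Real.exp (-(η * L)) ≤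
      48 * Real.exp (-(l * L₀)) * (Real.exp (-(2 * L)) - Real.exp (-(2 * ((L + 1 : ℕ) : ℝ)))) := by
    intro L hL
    have hLL : (L₀ : ℝ) ≤ L := by exact_mod_cast hL
    have h1 : ((L + 1 : ℕ) : ℝ) ≤ Real.exp L := by
      push_cast; exact Real.add_one_le_exp _
    have h2 : Real.exp L * Real.exp (-(η * L)) ≤ Real.exp (-(l * L₀)) * Real.exp (-(2 * L)) := by
      rw [← Real.exp_add, ← Real.exp_add]
      refine Real.exp_le_exp.2 ?_
      have e1 : (4 * l + 3) * L ≤ η * L := mul_le_mul_of_nonneg_right hη (by linarith)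
      have e2 : l * L₀ ≤ l * L := mul_le_mul_of_nonneg_left hLL hl0
      have e3 : 0 ≤ l * L := mul_nonneg hl0 (by linarith)
      linarith
    have h3 : Real.exp (-(2 * ((L + 1 : ℕ) : ℝ))) ≤ Real.exp (-(2 * L)) * (1 / 2) := by
      have e : -(2 * ((L + 1 : ℕ) : ℝ)) = -(2 * L) + -2 := by push_cast; ring
      rw [e, Real.exp_add]
      refine mul_le_mul_of_nonneg_left ?_ (Real.exp_pos _).le
      rw [Real.exp_neg, ← one_div]
      exact one_div_le_one_div_of_le two_pos (by linarith [Real.add_one_le_exp (2 : ℝ)])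
    have h4 := Real.exp_pos (-(l * L₀))
    calc _ ≤ 24 * Real.exp L * Real.exp (-(η * L)) := by gcongr
      _ ≤ 24 * (Real.exp (-(l * L₀)) * Real.exp (-(2 * L))) := by rw [mul_assoc]; gcongr
      _ = 48 * Real.exp (-(l * L₀)) * (Real.exp (-(2 * L)) - Real.exp (-(2 * L)) * (1 / 2)) := by
          ring
      _ ≤ _ := by gcongr
  have hind : ∀ L, L₀ ≤ L → ENNReal.ofReal (V - 48 * Real.exp (-(l * L₀)) *
      (Real.exp (-(2 * L₀)) - Real.exp (-(2 * L)))) ≤ volume (bands (a' L) (b' L) (q L)) := by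
    intro L hL
    induction L, hL using Nat.le_induction with
    | base => simpa using hstart
    | succ L hL ih =>
      have hη0 : 0 ≤ η := by linarith
      have h1 := ih.trans (volume_bands_le_add (Real.exp_le_exp.2 (by push_cast; nlinarith))
        (hq L hL) (hq (L + 1) (by omega)))
      have h2 := hstep L hL
      rw [← tsub_le_iff_right, ← ENNReal.ofReal_sub _ (by positivity)] at h1
      refine le_trans (ENNReal.ofReal_le_ofReal ?_) h1
      linarith
  refine ⟨V / 2, by positivity, eventually_atTop.2 ⟨L₀, fun L hL => ⟨_, _, _, hq L hL, ?_⟩⟩⟩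
  refine le_trans (ENNReal.ofReal_le_ofReal ?_) (hind L hL)
  have h1 : 48 * Real.exp (-(l * L₀)) * Real.exp (-(2 * L₀)) ≤ V / 2 := by
    have e : V / 2 = Real.exp (-(l * L₀)) * (1 / (2 * L₀ * D)) := by
      rw [hV]; field_simp
    rw [e, mul_comm 48, mul_assoc]
    refine mul_le_mul_of_nonneg_left ?_ (Real.exp_pos _).le
    rw [le_div_iff₀ (by positivity)]
    have h2 : Real.exp (-(2 * (L₀ : ℝ))) ≤ Real.exp (-(L₀ : ℝ)) :=
      Real.exp_le_exp.2 (by linarith)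
    have h3 : 96 * D * ((L₀ : ℝ) ^ 1 * Real.exp (-(L₀ : ℝ))) ≤ 1 := hsmall
    have h4 : 96 * D * L₀ * Real.exp (-(2 * (L₀ : ℝ))) ≤ 96 * D * L₀ * Real.exp (-(L₀ : ℝ)) := by
      gcongr
    rw [pow_one] at h3
    linarith
  have h2 : 0 ≤ 48 * Real.exp (-(l * L₀)) * Real.exp (-(2 * (L : ℝ))) := by positivity
  linarith

theorem eventually_log_affine_le {p r k : ℝ} (hp : 0 < p) (hk : 0 < k) :
    ∀ᶠ x : ℝ in atTop, Real.log (p * x + r) ≤ k * x := by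
  have ht : Tendsto (fun x : ℝ => p * x + r) atTop atTop :=
    tendsto_atTop_add_const_right _ _ (tendsto_id.const_mul_atTop hp)
  have h1 := ht.eventually (Real.isLittleO_log_id_atTop.def (c := k / (2 * p)) (by positivity))
  filter_upwards [h1, ht.eventually_ge_atTop 0, eventually_ge_atTop (r / p)] with x h1 h2 h3
  rw [Real.norm_eq_abs, id, Real.norm_of_nonneg h2] at h1
  rw [div_le_iff₀ hp] at h3
  calc _ ≤ k / (2 * p) * (p * x + r) := (le_abs_self _).trans h1
    _ ≤ k / (2 * p) * (p * x + x * p) := by gcongr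
    _ = k * x := by field_simp; ring

/-- Over `L` periods the periodic transfer matrices are moderate on the bands, and variation of
parameters carries this to the original operator. The prefactor keeps the actual period `q`; only
the error exponent is estimated with `q ≤ L`. -/
theorem norm_transfer_le_of_approximant {r : ℝ} {L q : ℕ} {a' b' : ℤ → ℝ}
    (hb : CoeffBounds a b α β γ) (h : PeriodicApproximant a b α β γ r L a' b' q)
    {x : ℝ} (hx : x ∈ bands a' b' q) :
    ‖transfer a b x (L * q)‖ ≤ (2 * L + 1) * stepBound α β γ ^ (2 * q) *
      Real.exp (3 * ((2 * L + 1) * stepBound α β γ ^ (2 * L)) ^ 2 *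
        (stepLipschitz α β γ * r) * (L * L)) := by
  have hxR : |x| ≤ 2 * β + γ + 1 := by
    linarith [h.bounds.abs_le_of_mem_bands h.period_pos h.periodic_hop h.periodic_field hx]
  have hκ := hb.one_le_stepBound
  have hD := hb.one_le_stepLipschitz
  have hr0 : 0 ≤ r := (abs_nonneg _).trans (h.hop_near 0)
  have h1 := norm_transfer_le_of_perturbation (a := a) (b := b) (z := (x : ℂ)) (N := L * q)
    h.bounds.hop_pos
    (fun n hn => norm_transfer_le_of_mem_bands h.bounds.hop_pos h.period_pos h.periodic_hop
      h.periodic_field hκ hx (h.bounds.norm_transferStep_le hxR) L n hn)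
    (fun k => hb.norm_transferStep_sub_le h.bounds hxR (h.hop_near k)
      (by rw [show x - b k - (x - b' k) = -(b k - b' k) by ring, abs_neg]; exact h.field_near k))
  refine h1.trans ?_
  have hqL : (q : ℝ) ≤ L := by exact_mod_cast h.period_le
  gcongr
  · exact h.period_le
  · push_cast; gcongr

/-- The velocity in a Lieb–Robinson bound is bounded below by the measure of the spectra of fast
periodic approximants of the one-particle operator. -/
theorem LiebRobinsonBound.le_velocity {C : Finset ℤ → Finset ℤ → ℝ} {c v : ℝ}
    (h : LiebRobinsonBound a b C c v) (hb : CoeffBounds a b α β γ) {η : ℝ}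
    (hη : 4 * Real.log (stepBound α β γ) + 3 ≤ η) {s : ℝ} (hs : 0 < s)
    (happ : ∀ᶠ L : ℕ in atTop, ∃ a' b' q,
      PeriodicApproximant a b α β γ (Real.exp (-(η * L))) L a' b' q ∧
        ENNReal.ofReal s ≤ volume (bands a' b' q)) : s / 2 ≤ v := by
  by_contra! hv
  set l := Real.log (stepBound α β γ) with hl
  have hκ1 : 1 ≤ stepBound α β γ := hb.one_le_stepBound
  have hl0 : 0 ≤ l := Real.log_nonneg hκ1
  have hκ : stepBound α β γ = Real.exp l := (Real.exp_log (by linarith)).symm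
  set D := stepLipschitz α β γ with hD
  have hD1 : 1 ≤ D := hb.one_le_stepLipschitz
  -- This makes `s * ε / w = 4 * ε`, to be compared with `π * ε`; `v < s / 2` says that `w` exceeds
  -- the one-particle velocity `v / 2`.
  set w := s / 4 with hw
  have hw0 : 0 < w := by positivity
  have hvw : v / 2 < w := by rw [hw]; linarith
  have hc := h.rate_pos
  have hv0 := h.velocity_pos
  set ε := c * (w - v / 2) with hε
  have hε0 : 0 < ε := mul_pos hc (by linarith)
  set C₀ := C {0} {0} with hC₀
  have hC0 : 0 < C₀ := h.prefactor_pos _ _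
  have hβ := hb.beta_pos
  -- The contradiction has the margin `k` per site. The two logarithms and the constants take at
  -- most `k / 8` each and the factor exponential in `q` takes `k / 2`, in total less than `k`.
  set k := (4 - Real.pi) * ε with hk
  have hk0 : 0 < k := mul_pos (by linarith [Real.pi_lt_four]) hε0
  -- the largeness conditions on the length scale
  have c1 : ∀ᶠ x : ℝ in atTop,
      Real.log (β * (C₀ / w) * x + β / ε) ≤ k / (8 * s) * x ∧
      Real.log (2 * x + 1) ≤ k / (8 * s) * x ∧ 4 * ε + s < k / 8 * x ∧ 1 ≤ x := by
    have e : ∀ᶠ x : ℝ in atTop, 4 * ε + s < k / 8 * x :=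
      (tendsto_id.const_mul_atTop (by positivity : 0 < k / 8)).eventually_gt_atTop _
    exact (eventually_log_affine_le (by positivity) (by positivity)).and
      ((eventually_log_affine_le two_pos (by positivity)).and (e.and (eventually_ge_atTop 1)))
  obtain ⟨X, hX⟩ := eventually_atTop.1 c1
  have c2 : ∀ᶠ L : ℕ in atTop, 27 * D * ((L : ℝ) ^ 4 * Real.exp (-(L : ℝ))) ≤ 1 := by
    have := ((Real.tendsto_pow_mul_exp_neg_atTop_nhds_zero 4).comp
      tendsto_natCast_atTop_atTop).const_mul (27 * D)
    rw [mul_zero] at this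
    exact this.eventually (ge_mem_nhds one_pos)
  have c3 : ∀ᶠ L : ℕ in atTop, 2 * s * l ≤ k / 2 * L :=
    (tendsto_natCast_atTop_atTop.const_mul_atTop
      (by positivity : 0 < k / 2)).eventually_ge_atTop _
  have c4 : ∀ᶠ L : ℕ in atTop, X ≤ (L : ℝ) := tendsto_natCast_atTop_atTop.eventually_ge_atTop X
  obtain ⟨L, ⟨a', b', q, hap, hvol⟩, hL2, hL3, hL4, hLge⟩ :=
    (happ.and (c2.and (c3.and (c4.and (eventually_ge_atTop 2))))).exists
  have hL1 : (1 : ℝ) ≤ L := by exact_mod_cast (by omega : 1 ≤ L)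
  have hq0 := hap.period_pos
  have hq1 : (1 : ℝ) ≤ q := by exact_mod_cast hq0
  -- The chain has `L` periods, so a cost exponential in `q` is only `O(1 / L)` per site in the
  -- logarithm. Two periods at least make the endpoints distinct.
  obtain ⟨M, hM⟩ : ∃ M, L * q = M + 1 :=
    ⟨L * q - 1, by have := Nat.mul_pos (by omega : 0 < L) hq0; omega⟩
  have hM0 : 0 < M := by
    have := Nat.mul_le_mul hLge hq0
    omega
  have hMN : (M : ℝ) + 1 = L * q := by exact_mod_cast hM.symm
  have hNL : (L : ℝ) ≤ L * q := by nlinarith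
  -- upper bound on the spectrum
  set B := (2 * L + 1) * stepBound α β γ ^ (2 * q) * Real.exp 1 with hB
  have hB0 : 0 < B := by positivity
  -- This fixes the rate: the squared growth bound contributes `exp (4 * l * L)`, and the remaining
  -- decay beats the polynomial factor.
  have hexp1 : 3 * ((2 * L + 1) * stepBound α β γ ^ (2 * L)) ^ 2 *
        (D * Real.exp (-(η * L))) * (L * L) ≤ 1 := by
    refine le_trans ?_ hL2
    have e1 : (stepBound α β γ ^ (2 * L)) ^ 2 * Real.exp (-(η * L)) ≤ Real.exp (-(L : ℝ)) := by
      rw [hκ, ← pow_mul, ← Real.exp_nat_mul, ← Real.exp_add]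
      refine Real.exp_le_exp.2 ?_
      have e1 : (4 * l + 3) * L ≤ η * L := mul_le_mul_of_nonneg_right hη (by linarith)
      push_cast
      linarith
    have e2 : (2 * (L : ℝ) + 1) ^ 2 ≤ 9 * (L : ℝ) ^ 2 := by nlinarith
    calc _ = 3 * D * (2 * (L : ℝ) + 1) ^ 2 * (L * L) *
          ((stepBound α β γ ^ (2 * L)) ^ 2 * Real.exp (-(η * L))) := by ring
      _ ≤ 3 * D * (9 * (L : ℝ) ^ 2) * (L * L) * Real.exp (-(L : ℝ)) := by gcongr
      _ = _ := by ring
  obtain ⟨p, hpdeg, hp⟩ := exists_transfer_poly a b (L * q) 0 0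
  set P : Polynomial ℂ := p.map (algebraMap ℝ ℂ) with hP
  have hPeval : ∀ z, P.eval z = transfer a b z (L * q) 0 0 := fun z => by
    rw [← hp, hP, Polynomial.eval_map_algebraMap]
  have hupper : ∀ x ∈ bands a' b' q, ‖P.eval (x : ℂ)‖ ≤ B := by
    intro x hx
    rw [hPeval]
    refine (norm_entry_le_l2 _ _ _).trans ((norm_transfer_le_of_approximant hb hap hx).trans ?_)
    rw [hB]
    gcongr
  -- lower bound off the real axis
  set A := Real.exp (ε * (M / w)) / (β * (1 / ε + C₀ * (M / w))) with hA
  have hden : 0 < β * (1 / ε + C₀ * (M / w)) := by positivity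
  have hA0 : 0 < A := by positivity
  have hlower : ∀ x ∈ bands a' b' q, A ≤ ‖P.eval (x + ε * Complex.I)‖ := by
    intro x _
    rw [hPeval, hM]
    have him : ((x : ℂ) + ε * Complex.I).im = ε := by simp
    have h1 := one_le_transfer_mul_of_propagator (b := b) hb.hop_pos
      (z := (x : ℂ) + ε * Complex.I) (by rw [him]; exact hε0) (M := M) (T := M / w)
      (B := C₀ * Real.exp (-(ε * (M / w)))) (by positivity) (by
        intro t ht
        refine (h.norm_propagator_le hM0 t).trans ?_
        refine mul_le_mul_of_nonneg_left (Real.exp_le_exp.2 ?_) hC0.le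
        rw [abs_of_nonneg ht.1]
        have e1 : v * (t / 2) ≤ v / 2 * (M / w) := by
          have := mul_le_mul_of_nonneg_left ht.2 (by positivity : 0 ≤ v / 2)
          linarith
        have e2 : ε * (M / w) = c * (M - v / 2 * (M / w)) := by
          rw [hε]; field_simp
        rw [e2, neg_mul]
        exact neg_le_neg (mul_le_mul_of_nonneg_left (by linarith) hc.le))
    rw [him] at h1
    rw [hA, div_le_iff₀ hden]
    have h2 : a M * ‖transfer a b (x + ε * Complex.I) (M + 1) 0 0‖ ≤
        β * ‖transfer a b (x + ε * Complex.I) (M + 1) 0 0‖ :=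
      mul_le_mul_of_nonneg_right (hb.hop_le _) (norm_nonneg _)
    have h3 : Real.exp (-(ε * (M / w))) / ε + C₀ * Real.exp (-(ε * (M / w))) * (M / w) =
        Real.exp (-(ε * (M / w))) * (1 / ε + C₀ * (M / w)) := by ring
    rw [h3] at h1
    have h4 := h1.trans (mul_le_mul_of_nonneg_right h2 (by positivity))
    have h5 : Real.exp (ε * (M / w)) * Real.exp (-(ε * (M / w))) = 1 := by
      rw [← Real.exp_add, add_neg_cancel, Real.exp_zero]
    have h6 := mul_le_mul_of_nonneg_left h4 (Real.exp_pos (ε * (M / w))).le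
    calc Real.exp (ε * (M / w)) ≤ _ := by simpa using h6
      _ = (Real.exp (ε * (M / w)) * Real.exp (-(ε * (M / w)))) *
          (‖transfer a b (x + ε * Complex.I) (M + 1) 0 0‖ * (β * (1 / ε + C₀ * (M / w)))) := by
          ring
      _ = _ := by rw [h5, one_mul]
  have hroots : ∀ r ∈ P.roots, r.im = 0 := by
    intro r hr
    have h1 : P.eval r = 0 := (Polynomial.mem_roots'.1 hr).2
    rw [hPeval, hM] at h1
    exact im_eq_zero_of_transfer_eq_zero hb.hop_pos h1
  have hmain := volume_mul_log_le hroots ((Polynomial.natDegree_map_le).trans hpdeg) hε0 hA0 hB0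
    hlower hupper
  have hmain' : Real.log (A / B) * s ≤ (L * q) * (Real.pi * ε) := by
    have h1 : ENNReal.ofReal (Real.log (A / B)) * ENNReal.ofReal s ≤
        ENNReal.ofReal ((L * q : ℕ) * (Real.pi * ε)) := by
      rw [ENNReal.ofReal_mul (by positivity), ENNReal.ofReal_natCast]
      exact le_trans (by gcongr) hmain
    rw [← ENNReal.ofReal_mul' hs.le, ENNReal.ofReal_le_ofReal_iff (by positivity)] at h1
    exact_mod_cast h1
  have hlog : Real.log (A / B) = ε * (M / w) - Real.log (β * (1 / ε + C₀ * (M / w))) -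
      (Real.log (2 * L + 1) + 2 * q * l + 1) := by
    have e : Real.log B = Real.log (2 * L + 1) + 2 * q * l + 1 := by
      rw [hB, Real.log_mul (by positivity) (Real.exp_pos _).ne', Real.log_exp,
        Real.log_mul (by positivity) (by positivity), Real.log_pow]
      push_cast; ring
    rw [Real.log_div hA0.ne' hB0.ne', hA, Real.log_div (Real.exp_pos _).ne' hden.ne',
      Real.log_exp, e]
  set N : ℝ := L * q with hN
  obtain ⟨d1, d2, d3, d4⟩ := hX N (hL4.trans hNL)
  have f1 : Real.log (β * (1 / ε + C₀ * (M / w))) ≤ k / (8 * s) * N := by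
    refine le_trans (Real.log_le_log hden ?_) d1
    have : (M : ℝ) ≤ N := by linarith
    calc β * (1 / ε + C₀ * (M / w)) ≤ β * (1 / ε + C₀ * (N / w)) := by gcongr
      _ = _ := by ring
  have f2 : Real.log (2 * L + 1) ≤ k / (8 * s) * N :=
    le_trans (Real.log_le_log (by positivity) (by linarith)) d2
  have f3 : s * (2 * q * l) ≤ k / 2 * N := by
    have := mul_le_mul_of_nonneg_right hL3 (by positivity : (0 : ℝ) ≤ q)
    rw [hN]; linarith
  have f4 : s * (ε * (M / w)) = 4 * ε * N - 4 * ε := by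
    have : (M : ℝ) = N - 1 := by linarith
    rw [this, hw]; field_simp
  have f5 : s * (k / (8 * s) * N) = k / 8 * N := by field_simp
  have g1 := mul_le_mul_of_nonneg_left f1 hs.le
  have g2 := mul_le_mul_of_nonneg_left f2 hs.le
  rw [f5] at g1 g2
  rw [hlog] at hmain'
  have g3 : s * (ε * (M / w)) - s * Real.log (β * (1 / ε + C₀ * (M / w))) -
      (s * Real.log (2 * L + 1) + s * (2 * q * l) + s) ≤ N * (Real.pi * ε) := by
    linarith
  have g4 : k * N = 4 * ε * N - N * (Real.pi * ε) := by rw [hk]; ring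
  have g5 : 0 < k * N := mul_pos hk0 (by linarith)
  linarith

end XYChain

/-! ### Choice of the approximants and conclusion -/

namespace XYChain

open MeasureTheory

/-- From errors that decay exponentially in the next period, a good approximant of each maximal
period. -/
theorem eventually_exists_period_le {q : ℕ → ℕ} {e₁ e₂ : ℕ → ℝ} {η : ℝ} (hη : 0 < η)
    (he₁ : ∀ n, 0 ≤ e₁ n) (he₂ : ∀ n, 0 ≤ e₂ n)
    (h₁ : Tendsto (fun n => Real.exp (η * (q (n + 1) : ℝ)) * e₁ n) atTop (𝓝 0))
    (h₂ : Tendsto (fun n => Real.exp (η * (q (n + 1) : ℝ)) * e₂ n) atTop (𝓝 0)) :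
    ∀ᶠ L : ℕ in atTop, ∃ n, q n ≤ L ∧ e₁ n ≤ Real.exp (-(η * L)) ∧
      e₂ n ≤ Real.exp (-(η * L)) := by
  have hexp1 : ∀ n, 1 ≤ Real.exp (η * (q (n + 1) : ℝ)) := fun n =>
    Real.one_le_exp (by positivity)
  have hsmall : ∀ {e : ℕ → ℝ}, (∀ n, 0 ≤ e n) →
      Tendsto (fun n => Real.exp (η * (q (n + 1) : ℝ)) * e n) atTop (𝓝 0) →
      Tendsto e atTop (𝓝 0) := fun he h =>
    squeeze_zero he (fun n => le_mul_of_one_le_left (he n) (hexp1 n)) h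
  obtain ⟨n₁, hn₁⟩ := eventually_atTop.1 ((h₁.eventually (ge_mem_nhds one_pos)).and
    (h₂.eventually (ge_mem_nhds one_pos)))
  filter_upwards [eventually_ge_atTop (q n₁)] with L hL
  -- If periods at most `L` recur, a late approximant is good enough since the errors tend to zero.
  -- Otherwise the last `n` with `q n ≤ L` has `L < q (n + 1)`, and its error is controlled at the
  -- scale of the next period.
  by_cases hf : ∃ᶠ n in atTop, q n ≤ L
  · have hpos : 0 < Real.exp (-(η * L)) := Real.exp_pos _
    obtain ⟨n, hn, h1, h2⟩ := (hf.and_eventually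
      (((hsmall he₁ h₁).eventually (ge_mem_nhds hpos)).and
        ((hsmall he₂ h₂).eventually (ge_mem_nhds hpos)))).exists
    exact ⟨n, hn, h1, h2⟩
  · rw [not_frequently] at hf
    obtain ⟨m, hm⟩ := eventually_atTop.1 hf
    have hn₁m : n₁ ≤ m := by
      by_contra hcon
      exact hm n₁ (by omega) hL
    set n := Nat.findGreatest (fun n => q n ≤ L) m with hn
    have hqn : q n ≤ L := Nat.findGreatest_spec (P := fun n => q n ≤ L) hn₁m hL
    have hn₁n : n₁ ≤ n := Nat.le_findGreatest hn₁m hL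
    have hnext : L < q (n + 1) := by
      by_contra hcon
      rcases le_or_gt (n + 1) m with h | h
      · exact Nat.findGreatest_is_greatest (P := fun n => q n ≤ L) (Nat.lt_succ_self n) h
          (not_lt.1 hcon)
      · exact hm (n + 1) h.le (not_lt.1 hcon)
    have hbound : ∀ {x : ℝ}, Real.exp (η * (q (n + 1) : ℝ)) * x ≤ 1 → 0 ≤ x →
        x ≤ Real.exp (-(η * L)) := by
      intro x hx hx0
      have hLq : (L : ℝ) ≤ q (n + 1) := by exact_mod_cast hnext.le
      have h1 : Real.exp (η * L) * x ≤ 1 := by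
        refine le_trans ?_ hx
        gcongr
      rw [Real.exp_neg, ← one_div, le_div_iff₀ (Real.exp_pos _)]
      linarith
    obtain ⟨b1, b2⟩ := hn₁ n hn₁n
    exact ⟨n, hqn, hbound b1 (he₁ n), hbound b2 (he₂ n)⟩

/-- The rate of approximation required of the periodic approximants, in terms of `‖μ‖`, `‖μ⁻¹‖`
and `‖ν‖`. -/
def approximationRate (x y z : ℝ) : ℝ :=
  4 * Real.log (stepBound (1 / (2 * (|y| + 1))) (|x| + 1) (|z| + 1)) + 3

theorem approximationRate_pos (x y z : ℝ) : 0 < approximationRate x y z := by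
  have h : 1 ≤ stepBound (1 / (2 * (|y| + 1))) (|x| + 1) (|z| + 1) := by
    unfold stepBound
    have h1 : 0 ≤ (2 * (|x| + 1) + 2 * (|z| + 1) + 2) / (1 / (2 * (|y| + 1))) := by positivity
    linarith [abs_nonneg x]
  have := Real.log_nonneg h
  unfold approximationRate
  linarith

end XYChain

end

theorem theoremt :
    ∃ η₀ : ℝ → ℝ → ℝ → ℝ, (∀ x y z, 0 < η₀ x y z) ∧
      ∀ μ ν : lp (fun _ : ℤ => ℝ) ⊤, 0 < ⨅ j, μ j →
        (∃ (q : ℕ → ℕ) (μ' ν' : ℕ → lp (fun _ : ℤ => ℝ) ⊤),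
          (∀ n, 0 < q n) ∧
          (∀ n, Function.Periodic (μ' n : ℤ → ℝ) (q n : ℤ)) ∧
          (∀ n, Function.Periodic (ν' n : ℤ → ℝ) (q n : ℤ)) ∧
          Tendsto (fun n => Real.exp (η₀ ‖μ‖ (⨆ j, |(μ j)⁻¹|) ‖ν‖ * (q (n + 1) : ℝ)) * ‖μ - μ' n‖)
            atTop (𝓝 0) ∧
          Tendsto (fun n => Real.exp (η₀ ‖μ‖ (⨆ j, |(μ j)⁻¹|) ‖ν‖ * (q (n + 1) : ℝ)) * ‖ν - ν' n‖)
            atTop (𝓝 0)) →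
        ∃ v₀ : ℝ, 0 < v₀ ∧
          ∀ (C : Finset ℤ → Finset ℤ → ℝ) (c v : ℝ),
            XYChain.LiebRobinsonBound μ ν C c v → v₀ ≤ v := by
  refine ⟨XYChain.approximationRate, XYChain.approximationRate_pos, ?_⟩
  rintro μ ν hμ ⟨q, μ', ν', hq, hμ', hν', hlimμ, hlimν⟩
  set y := ⨆ j, |(μ j)⁻¹| with hy
  -- Half of a lower bound for `μ`, and `β`, `γ` one above the norms: approximants with error at
  -- most `α` and 1 then satisfy the same bounds. The absolute values make the rate positive at all
  -- real arguments.
  set α := 1 / (2 * (|y| + 1)) with hα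
  set β := |‖μ‖| + 1 with hβ
  set γ := |‖ν‖| + 1 with hγ
  set η := XYChain.approximationRate ‖μ‖ y ‖ν‖ with hη
  have hη0 : 0 < η := XYChain.approximationRate_pos _ _ _
  have hα0 : 0 < α := by positivity
  have hμabs : ∀ (f : lp (fun _ : ℤ => ℝ) ⊤) (j : ℤ), |f j| ≤ ‖f‖ := fun f j =>
    lp.norm_apply_le_norm ENNReal.top_ne_zero f j
  have hbdd : BddBelow (Set.range fun j => μ j) :=
    ⟨-‖μ‖, by rintro _ ⟨j, rfl⟩; exact (abs_le.1 (hμabs μ j)).1⟩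
  have hμinf : ∀ j, (⨅ j, μ j) ≤ μ j := fun j => ciInf_le hbdd j
  have hμpos : ∀ j, 0 < μ j := fun j => hμ.trans_le (hμinf j)
  have hinvbdd : BddAbove (Set.range fun j => |(μ j)⁻¹|) := by
    refine ⟨(⨅ j, μ j)⁻¹, ?_⟩
    rintro _ ⟨j, rfl⟩
    show |(μ j)⁻¹| ≤ _
    rw [abs_of_pos (inv_pos.2 (hμpos j))]
    exact inv_anti₀ hμ (hμinf j)
  have hμlow : ∀ j, 2 * α ≤ μ j := by
    intro j
    have h1 : (μ j)⁻¹ ≤ |y| + 1 := by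
      have h2 : |(μ j)⁻¹| ≤ y := le_ciSup hinvbdd j
      linarith [le_abs_self y, le_abs_self (μ j)⁻¹]
    have h3 : 2 * α = (|y| + 1)⁻¹ := by rw [hα]; field_simp
    rw [h3]
    exact inv_le_of_inv_le₀ (hμpos j) h1
  have hb : XYChain.CoeffBounds μ ν α β γ :=
    { pos := hα0
      le_hop := fun j => by linarith [hμlow j]
      hop_le := fun j => by
        linarith [le_abs_self ‖μ‖, (le_abs_self (μ j)).trans (hμabs μ j)]
      field_le := fun j => by linarith [le_abs_self ‖ν‖, hμabs ν j] }
  have hηlim : Tendsto (fun L : ℕ => Real.exp (-(η * L))) atTop (𝓝 0) :=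
    Real.tendsto_exp_neg_atTop_nhds_zero.comp
      (tendsto_natCast_atTop_atTop.const_mul_atTop hη0)
  have happ : ∀ᶠ L : ℕ in atTop, ∃ a' b' q,
      XYChain.PeriodicApproximant μ ν α β γ (Real.exp (-(η * L))) L a' b' q := by
    filter_upwards [XYChain.eventually_exists_period_le hη0 (fun n => norm_nonneg (μ - μ' n))
      (fun n => norm_nonneg (ν - ν' n)) hlimμ hlimν, hηlim.eventually (ge_mem_nhds hα0),
      hηlim.eventually (ge_mem_nhds one_pos)] with L hL hLα hL1
    obtain ⟨n, hqn, h1, h2⟩ := hL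
    have n1 : ∀ j, |μ j - μ' n j| ≤ Real.exp (-(η * L)) := fun j =>
      (hμabs (μ - μ' n) j).trans h1
    have n2 : ∀ j, |ν j - ν' n j| ≤ Real.exp (-(η * L)) := fun j =>
      (hμabs (ν - ν' n) j).trans h2
    refine ⟨μ' n, ν' n, q n, ⟨⟨hα0, fun j => ?_, fun j => ?_, fun j => ?_⟩, hq n, hqn, hμ' n,
      hν' n, n1, n2⟩⟩
    · have := (abs_le.1 (n1 j)).2
      linarith [hμlow j]
    · have := (abs_le.1 (n1 j)).1
      linarith [le_abs_self ‖μ‖, (le_abs_self (μ j)).trans (hμabs μ j)]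
    · have := (n2 j).trans hL1
      rw [abs_sub_comm] at this
      have h3 := abs_add_le (ν' n j - ν j) (ν j)
      rw [sub_add_cancel] at h3
      linarith [le_abs_self ‖ν‖, hμabs ν j]
  obtain ⟨s, hs, hvol⟩ := XYChain.exists_le_volume_bands le_rfl happ
  exact ⟨s / 2, by positivity, fun C c v h => h.le_velocity hb le_rfl hs hvol⟩
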